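/- Let $T\subset\mathbb{R}^2$ be the triangle with vertices $(0,0),(0,1),(1,0)$, let $X_1,\dots,X_n$ be independent random points uniformly distributed in $T$, and let $T_n$ be the convex hull of $X_1,\dots,X_n$ together with $(0,1)$ and $(1,0)$. Let $f_0(T_n)$ be the number of vertices of $T_n$ other than $(0,1)$ and $(1,0)$, put $p_n^{(k)}=\mathbb{P}(f_0(T_n)=k)$, and let $G_0(z)=1$ and $G_n(z)=\sum_{k=1}^n p_n^{(k)}z^k$ for $n\ge 1$. Then $$p_n^{(n)}=\frac{2^n}{n!\,(n+1)!}\qquad(n\ge 0),$$ and $H_n:=G_n/p_n^{(n)}$ $(n\ge 0)$ is a monic polynomial of degree $n$. These polynomials satisfy $H_0(z)=1$, $H_1(z)=z$ and the three-term recurrence $$H_n(z)=\bigl(z+n(n-1)\bigr)H_{n-1}(z)-\frac{n(n-1)^2(n-2)}{4}\,H_{n-2}(z),\qquad n\ge 2,\ z\in\mathbb{R}.$$ They are orthogonal in the following sense (Favard). There is exactly one Borel probability measure $\mu$ on $\mathbb{R}$ for which all products $H_mH_n$ $(m,n\ge 0)$ are integrable and $\int H_mH_n\,d\mu=0$ whenever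 $m\neq n$. Moreover, there is a positive Borel measure $\nu$ on $\mathbb{R}$ for which all products $H_mH_n$ with $m,n\ge 1$ are integrable, $\int H_mH_n\,d\nu=0$ whenever $m\ne n$, and $\int H_n^2\,d\nu>0$ for all $n\geq 1$. (For the whole sequence $(H_n)_{n\ge0}$ one cannot have positive norms, because the last coefficient of the recurrence vanishes for $n=2$.) -/

import Mathlib

open Polynomial MeasureTheory

namespace RandomConvexChain

/-- The triangle `T` in the plane with vertices `(0,0)`, `(0,1)` and `(1,0)`. -/
def triangle : Set (ℝ × ℝ) := convexHull ℝ {(0, 0), (0, 1), (1, 0)}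

/-- The two corners `(0,1)` and `(1,0)` of the triangle that span every convex chain. -/
def corners : Set (ℝ × ℝ) := {(0, 1), (1, 0)}

/-- The uniform distribution on the triangle: normalised Lebesgue measure. -/
noncomputable def uniformTriangle : Measure (ℝ × ℝ) :=
  ProbabilityTheory.cond volume triangle

/-- The joint law of `n` independent points, each uniformly distributed in the triangle. -/
noncomputable def sampleLaw (n : ℕ) : Measure (Fin n → ℝ × ℝ) :=
  Measure.pi fun _ => uniformTriangle

/-- The convex chain generated by the points `x 0, …, x (n-1)`: the convex hull of these points
together with the two corners. -/
def chain {n : ℕ} (x : Fin n → ℝ × ℝ) : Set (ℝ × ℝ) :=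
  convexHull ℝ (Set.range x ∪ corners)

/-- The number of vertices of the chain. The two corners, which are vertices of every chain of
points of the triangle, are not counted. -/
noncomputable def vertexCount {n : ℕ} (x : Fin n → ℝ × ℝ) : ℕ :=
  ((chain x).extremePoints ℝ \ corners).ncard

/-- `vertexProb n k` is the probability that the random convex chain of `n` points has exactly
`k` vertices. -/
noncomputable def vertexProb (n k : ℕ) : ℝ :=
  (sampleLaw n).real {x | vertexCount x = k}

/-- The probability generating function `G n = ∑ k = 1, …, n, vertexProb n k * z ^ k` of the
number of vertices, with the convention `G 0 = 1`. -/
noncomputable def G (n : ℕ) : ℝ[X] :=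
  if n = 0 then 1 else ∑ k ∈ Finset.Icc 1 n, C (vertexProb n k) * X ^ k

/-- The normalisation `H n = G n / vertexProb n n`. -/
noncomputable def H (n : ℕ) : ℝ[X] := C (vertexProb n n)⁻¹ * G n

/-- The family `P` is orthogonal with respect to `⟨f, g⟩ = ∫ f g dμ`: all these integrals
converge, and those with different indices vanish. -/
def IsOrthogonal {ι : Type*} (μ : Measure ℝ) (P : ι → ℝ[X]) : Prop :=
  (∀ i j, Integrable (fun x => (P i).eval x * (P j).eval x) μ) ∧
    ∀ i j, i ≠ j → ∫ x, (P i).eval x * (P j).eval x ∂μ = 0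

end RandomConvexChain

/-!
Two independent ingredients carry the proof: a recurrence for the vertex probabilities, and an
explicit orthogonality measure.

**The recurrence.** Among the `n` random points, let `V` be the one that comes last on the chain,
that is, the point whose line through the corner `(1,0)` is lowest. Given `V`, every other point
lies above that line, either in the *lower* triangle spanned by `V` and the two corners, or in the
*upper* triangle which has `V` and `(0,1)` as corners and its third vertex on the line through
`(1,0)` and `V`. Points in the lower triangle are irrelevant; those in the upper triangle span a
random convex chain there, because the uniform law is affinely invariant, and `V` contributes one
more vertex (`vertexNumber_insert`). Conditioning on the set of points in the upper triangle
(`sampleLaw_above`) and integrating over `V`, which leads to a beta integral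
(`lintegral_upperArea_mul_lowerArea`), gives
`n (n + 1) p_n^(k + 1) = 2 ∑_{m < n} (n - m) p_m^(k)` (`vertexProb_succ_succ`). Taking second
differences of the generating polynomials turns this into the three-term recurrence
(`eval_G_recurrence`, `eval_H_recurrence`), and the value of `p_n^(n)` follows as well.

**The measures.** For `n ≥ 1` the polynomial `H n` vanishes at `0`, so the whole sequence is
orthogonal for the Dirac measure at `0`; orthogonality of `H 0` to `H 1` and `H 2` forces the first
two moments to vanish, which gives uniqueness. For the polynomials of positive degree put
`z = -(t ^ 2 + 1 / 4) / 2`. Divided by `z` they are continuous dual Hahn polynomials in `t`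
with parameters `1/2, 3/2, 3/2`; the weight of that family is proportional to `z ^ 2 w(t)` with
`w(t) = t sinh (π t) / cosh (π t) ^ 2`, so `w(t) dt` is the measure to use (`chainMeasure`).
With `U_k = ∏_{j < k} (j (j + 1) - 2 z)` the recurrence yields the expansion
`G n = ∑_k (-1) ^ k (n - 1 choose k - 1) / (k! (k + 1)!) U_k` (`G_succ_eq_sum`). A contour shift from
`Im t = -1 / 2` to `Im t = 1 / 2` shows `∫ U_{k + 1} = (k + 1) ^ 2 ∫ U_k`
(`integral_sub_mul_halfProd_mul_weight`, `chainFunctional_shiftedProd_succ`), so that `∫ z H n` is a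
multiple of an alternating sum of binomial coefficients and vanishes for `n ≥ 2`. The three-term
recurrence propagates this to `∫ z ^ j H n = 0` for `1 ≤ j < n`, which is orthogonality since `z`
divides `H m` for `m ≥ 1`.
-/

namespace RandomConvexChain

/-! ### Removing the last vertex of a chain -/

/-- The number of vertices, other than the two corners, of the convex hull of a set of points
together with the corners; `vertexCount x` is `vertexNumber (Set.range x)`. -/
noncomputable def vertexNumber (P : Set (ℝ × ℝ)) : ℕ :=
  ((convexHull ℝ (P ∪ corners)).extremePoints ℝ \ corners).ncard

/-- The affine map sending `(0,0)`, `(1,0)`, `(0,1)` to `a`, `b`, `c`. -/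
noncomputable def triMap (a b c : ℝ × ℝ) : (ℝ × ℝ) →ᵃ[ℝ] (ℝ × ℝ) where
  toFun p := a + p.1 • (b - a) + p.2 • (c - a)
  linear := (LinearMap.fst ℝ ℝ ℝ).smulRight (b - a) + (LinearMap.snd ℝ ℝ ℝ).smulRight (c - a)
  map_vadd' p v := by
    simp only [vadd_eq_add, Prod.fst_add, Prod.snd_add, LinearMap.add_apply,
      LinearMap.smulRight_apply, LinearMap.fst_apply, LinearMap.snd_apply]
    module

lemma triMap_apply (a b c p : ℝ × ℝ) :
    triMap a b c p = a + p.1 • (b - a) + p.2 • (c - a) := rfl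

lemma triangle_eq : triangle = {p : ℝ × ℝ | 0 ≤ p.1 ∧ 0 ≤ p.2 ∧ p.1 + p.2 ≤ 1} := by
  apply Set.Subset.antisymm
  · apply convexHull_min
    · rintro p (rfl | rfl | rfl) <;> norm_num
    · rintro p ⟨h1, h2, h3⟩ q ⟨k1, k2, k3⟩ a b ha hb hab
      simp only [Set.mem_ofPred_eq, Prod.fst_add, Prod.snd_add, Prod.smul_fst, Prod.smul_snd,
        smul_eq_mul]
      refine ⟨by positivity, by positivity, ?_⟩
      nlinarith
  · rintro ⟨x, y⟩ ⟨h1, h2, h3⟩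
    have e : ((x, y) : ℝ × ℝ) = (1 - x - y) • ((0, 0) : ℝ × ℝ) + y • ((0, 1) : ℝ × ℝ)
        + x • ((1, 0) : ℝ × ℝ) := by ext <;> simp
    rw [e]
    simp only at h1 h2 h3
    have := (convex_convexHull ℝ {((0, 0) : ℝ × ℝ), (0, 1), (1, 0)}).sum_mem (t := Finset.univ)
      (w := ![1 - x - y, y, x]) (z := ![((0, 0) : ℝ × ℝ), (0, 1), (1, 0)])
      (by
        intro i _
        fin_cases i
        · change 0 ≤ 1 - x - y; linarith
        · exact h2
        · exact h1)
      (by simp [Fin.sum_univ_three])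
      (by
        intro i _
        apply subset_convexHull
        fin_cases i <;> simp)
    unfold triangle
    simpa [Fin.sum_univ_three] using this

lemma extremePoints_image {f : (ℝ × ℝ) →ᵃ[ℝ] (ℝ × ℝ)} (hf : Function.Injective f)
    (K : Set (ℝ × ℝ)) : (f '' K).extremePoints ℝ = f '' K.extremePoints ℝ := by
  apply Set.Subset.antisymm
  · rintro _ ⟨⟨x, hx, rfl⟩, h⟩
    refine ⟨x, ⟨hx, fun y hy z hz hyz => hf (h ⟨y, hy, rfl⟩ ⟨z, hz, rfl⟩ ?_)⟩, rfl⟩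
    rw [← image_openSegment]
    exact ⟨x, hyz, rfl⟩
  · rintro _ ⟨x, ⟨hx, h⟩, rfl⟩
    refine ⟨⟨x, hx, rfl⟩, ?_⟩
    rintro _ ⟨y, hy, rfl⟩ _ ⟨z, hz, rfl⟩ hyz
    rw [← image_openSegment] at hyz
    obtain ⟨w, hw, hwx⟩ := hyz
    rw [hf hwx] at hw
    rw [h hy hz hw]

/-- Let `L` be a convex subset of the triangle which contains both corners and meets the horizontal
axis only in `(1,0)`. Seen from a point `(c, 0)` with `c > 1`, it lies behind the segment between
the corners, so no extreme point of `L` is lost when that point is added. -/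
lemma mem_extremePoints_insert {L : Set (ℝ × ℝ)} (hL : Convex ℝ L) (hLT : L ⊆ triangle)
    (hcor : corners ⊆ L) (hax : ∀ p ∈ L, p.2 = 0 → p = (1, 0)) {c : ℝ} (hc : 1 < c)
    {p : ℝ × ℝ} (hp : p ∈ L.extremePoints ℝ) :
    p ∈ (convexHull ℝ (insert (c, 0) L)).extremePoints ℝ := by
  have h10 : ((1, 0) : ℝ × ℝ) ∈ L := hcor (by simp [corners])
  have h01 : ((0, 1) : ℝ × ℝ) ∈ L := hcor (by simp [corners])
  refine ⟨subset_convexHull ℝ _ (Set.mem_insert_of_mem _ hp.1), ?_⟩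
  have hdec : ∀ x ∈ convexHull ℝ (insert ((c, 0) : ℝ × ℝ) L), ∃ a : ℝ, ∃ k ∈ L,
      0 ≤ a ∧ a ≤ 1 ∧ x = a • ((c, 0) : ℝ × ℝ) + (1 - a) • k := by
    intro x hx
    rw [convexHull_insert ⟨_, h10⟩, hL.convexHull_eq, convexJoin_singleton_left] at hx
    simp only [Set.mem_iUnion] at hx
    obtain ⟨k, hk, a, b, ha, hb, hab, rfl⟩ := hx
    obtain rfl : b = 1 - a := by linarith
    exact ⟨a, k, hk, ha, by linarith, rfl⟩
  intro x hx y hy hxy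
  obtain ⟨a₁, k₁, hk₁, ha₁, ha₁', rfl⟩ := hdec x hx
  obtain ⟨a₂, k₂, hk₂, ha₂, ha₂', rfl⟩ := hdec y hy
  obtain ⟨s, t, hs, ht, hst, hp'⟩ := hxy
  have hT : ∀ q ∈ L, 0 ≤ q.1 ∧ 0 ≤ q.2 ∧ q.1 + q.2 ≤ 1 := fun q hq => by
    have := hLT hq
    rwa [triangle_eq] at this
  obtain ⟨hp1, hp2, hp3⟩ := hT p hp.1
  -- `γ` is the weight of `(c, 0)` in the representation of `p`
  obtain ⟨γ, hγ⟩ : ∃ γ, γ = s * a₁ + t * a₂ := ⟨_, rfl⟩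
  have hγ0 : 0 ≤ γ := by rw [hγ]; positivity
  rcases hγ0.eq_or_lt with h0 | hγ0
  · have e1 : a₁ = 0 := by
      by_contra h
      have : 0 < a₁ := lt_of_le_of_ne ha₁ (Ne.symm h)
      have : 0 < s * a₁ + t * a₂ := by positivity
      linarith
    have e2 : a₂ = 0 := by
      by_contra h
      have : 0 < a₂ := lt_of_le_of_ne ha₂ (Ne.symm h)
      have : 0 < s * a₁ + t * a₂ := by positivity
      linarith
    subst e1 e2
    have := hp.2 hk₁ hk₂ ⟨s, t, hs, ht, hst, by simpa using hp'⟩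
    simpa using this
  exfalso
  have hγ1 : γ < 1 := by
    by_contra h
    have e1 : a₁ = 1 := by nlinarith
    have e2 : a₂ = 1 := by nlinarith
    subst e1 e2
    have := congrArg Prod.fst hp'
    simp at this
    have : c = p.1 := by rw [← this, ← add_mul, hst, one_mul]
    linarith
  have hγ' : 0 < 1 - γ := by linarith
  obtain ⟨k, hk, hpk⟩ : ∃ k ∈ L, p = γ • ((c, 0) : ℝ × ℝ) + (1 - γ) • k := by
    refine ⟨(s * (1 - a₁) / (1 - γ)) • k₁ + (t * (1 - a₂) / (1 - γ)) • k₂,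
      hL hk₁ hk₂ ?_ ?_ ?_, ?_⟩
    · have := sub_nonneg.2 ha₁'; positivity
    · have := sub_nonneg.2 ha₂'; positivity
    · rw [← add_div, div_eq_one_iff_eq hγ'.ne', hγ]; linear_combination hst
    · rw [← hp', smul_add (1 - γ), smul_smul (1 - γ), smul_smul (1 - γ), mul_div_cancel₀ _ hγ'.ne',
        mul_div_cancel₀ _ hγ'.ne', hγ]
      module
  have hk1 := congrArg Prod.fst hpk
  have hk2 := congrArg Prod.snd hpk
  simp only [Prod.fst_add, Prod.snd_add, Prod.smul_fst, Prod.smul_snd, smul_eq_mul, mul_zero,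
    zero_add] at hk1 hk2
  obtain ⟨kT1, kT2, kT3⟩ := hT k hk
  rcases hp2.eq_or_lt with h20 | h20
  · have : k.2 = 0 := by
      rw [← h20] at hk2
      rcases mul_eq_zero.1 hk2.symm with h | h
      · linarith
      · exact h
    rw [hax k hk this] at hk1
    simp at hk1
    nlinarith
  have hkp : p.2 < k.2 := by nlinarith
  rcases hp3.eq_or_lt with h1 | h1
  · rcases hp1.eq_or_lt with h | h
    · linarith
    · have hopen : p ∈ openSegment ℝ ((1, 0) : ℝ × ℝ) (0, 1) :=
        ⟨p.1, p.2, h, h20, h1, by ext <;> simp⟩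
      have := congrArg Prod.snd (hp.2 h10 h01 hopen)
      simp at this
      linarith
  -- `q` is the point where the segment from `p` to `(c, 0)` crosses the hypotenuse
  obtain ⟨τ, hτ⟩ : ∃ τ, τ = (1 - (p.1 + p.2)) / (c - (p.1 + p.2)) := ⟨_, rfl⟩
  have hden : 0 < c - (p.1 + p.2) := by linarith
  have hτ0 : 0 < τ := by rw [hτ]; exact div_pos (by linarith) hden
  have hτ1 : τ < 1 := by rw [hτ, div_lt_one hden]; linarith
  have hτe : τ * (c - (p.1 + p.2)) = 1 - (p.1 + p.2) := by
    rw [hτ, div_mul_cancel₀ _ hden.ne']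
  have hq : (1 - τ) • p + τ • ((c, 0) : ℝ × ℝ) ∈ L := by
    have e : (1 - τ) • p + τ • ((c, 0) : ℝ × ℝ)
        = (1 - (1 - τ) * p.2) • ((1, 0) : ℝ × ℝ) + ((1 - τ) * p.2) • ((0, 1) : ℝ × ℝ) := by
      ext
      · simp; linear_combination hτe
      · simp
    rw [e]
    exact hL h10 h01 (by nlinarith) (mul_nonneg (by linarith) hp2) (by ring)
  have hD : 0 < τ + γ - γ * τ := by nlinarith
  have hopen : p ∈ openSegment ℝ k ((1 - τ) • p + τ • ((c, 0) : ℝ × ℝ)) := by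
    refine ⟨τ * (1 - γ) / (τ + γ - γ * τ), γ / (τ + γ - γ * τ), by positivity, by positivity, ?_, ?_⟩
    · rw [← add_div, div_eq_one_iff_eq hD.ne']; ring
    · ext
      · simp only [Prod.fst_add, Prod.smul_fst, smul_eq_mul]
        rw [div_mul_eq_mul_div, div_mul_eq_mul_div, ← add_div, div_eq_iff hD.ne']
        linear_combination (-τ) * hk1
      · simp only [Prod.snd_add, Prod.smul_snd, smul_eq_mul]
        rw [div_mul_eq_mul_div, div_mul_eq_mul_div, ← add_div, div_eq_iff hD.ne']
        linear_combination (-τ) * hk2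
  have := congrArg Prod.snd (hp.2 hk hq hopen)
  linarith

/-- The affine map takes the triangle to the one with vertices `V`, `(0,1)` and a third vertex on the
line through `(1,0)` and `V`, and its horizontal side into that line. If every point other than `V`
lies in the image, strictly above the line, or in the triangle with vertices `V`, `(1,0)`, `(0,1)`,
then `V` is a vertex, and the other vertices are those of the chain that the points in the image
span with the corners `V` and `(0,1)`. -/
lemma vertexNumber_insert {V : ℝ × ℝ} (h1 : 0 < V.1) (h2 : V.1 + V.2 < 1)
    {W D : Set (ℝ × ℝ)} (hWf : W.Finite) (hW : W ⊆ triangle) (hW2 : ∀ w ∈ W, 0 < w.2)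
    (hD : D ⊆ convexHull ℝ {V, (1, 0), (0, 1)}) (hV2 : 0 ≤ V.2) :
    vertexNumber (insert V (triMap (0, V.2 / (1 - V.1)) V (0, 1) '' W ∪ D))
      = vertexNumber W + 1 := by
  set f := triMap (0, V.2 / (1 - V.1)) V (0, 1) with hf
  obtain ⟨v, u⟩ := V
  simp only at h1 h2 hV2 hf
  have hv1 : 0 < 1 - v := by linarith
  have f10 : f (1, 0) = (v, u) := by rw [hf, triMap_apply]; simp
  have f01 : f (0, 1) = (0, 1) := by rw [hf, triMap_apply]; simp
  have fc : f (1 / v, 0) = (1, 0) := by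
    rw [hf, triMap_apply]; ext
    · simp; field_simp
    · simp; field_simp; ring
  have hinj : Function.Injective f := by
    rintro ⟨x, y⟩ ⟨x', y'⟩ h
    rw [hf, triMap_apply, triMap_apply, Prod.ext_iff] at h
    simp only [Prod.fst_add, Prod.snd_add, Prod.smul_fst, Prod.smul_snd, Prod.fst_sub,
      Prod.snd_sub, smul_eq_mul] at h
    obtain ⟨ha, hb⟩ := h
    have hx : x = x' := by
      have : v * (x - x') = 0 := by linear_combination ha
      rcases mul_eq_zero.1 this with h | h <;> linarith
    subst hx
    have : (1 - u / (1 - v)) * (y - y') = 0 := by linear_combination hb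
    rcases mul_eq_zero.1 this with h | h
    · have : u / (1 - v) < 1 := by rw [div_lt_one hv1]; linarith
      linarith
    · rw [sub_eq_zero.1 h]
  set L := convexHull ℝ (W ∪ corners) with hL
  have hcorT : corners ⊆ triangle := by
    rintro p (rfl | rfl) <;> rw [triangle_eq] <;> norm_num
  have hLT : L ⊆ triangle := convexHull_min (Set.union_subset hW hcorT) (convex_convexHull ℝ _)
  have hcorL : corners ⊆ L := Set.subset_union_right.trans (subset_convexHull ℝ _)
  have hax : ∀ p ∈ L, p.2 = 0 → p = (1, 0) := by
    have hconv : Convex ℝ {p : ℝ × ℝ | 0 < p.2 ∨ p = (1, 0)} := by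
      rintro p hp q hq a b ha hb hab
      have hp0 : 0 ≤ p.2 := by rcases hp with h | rfl; exacts [h.le, le_rfl]
      have hq0 : 0 ≤ q.2 := by rcases hq with h | rfl; exacts [h.le, le_rfl]
      rcases ha.eq_or_lt with rfl | ha
      · obtain rfl : b = 1 := by linarith
        simpa using hq
      rcases hb.eq_or_lt with rfl | hb
      · obtain rfl : a = 1 := by linarith
        simpa using hp
      rcases hp with h | rfl
      · left; simp; have := mul_pos ha h; have := mul_nonneg hb.le hq0; linarith
      rcases hq with h | rfl
      · left; simp; have := mul_pos hb h; linarith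
      right
      rw [← add_smul, hab, one_smul]
    have : L ⊆ {p : ℝ × ℝ | 0 < p.2 ∨ p = (1, 0)} := by
      refine convexHull_min ?_ hconv
      rintro p (hp | rfl | rfl)
      · exact Or.inl (hW2 p hp)
      · left; norm_num
      · right; rfl
    intro p hp h0
    rcases this hp with h | h
    · linarith
    · exact h
  have hc : 1 < 1 / v := by rw [lt_div_iff₀ h1]; linarith
  have hcL : ((1 / v, 0) : ℝ × ℝ) ∉ L := fun h => by
    have := hax _ h rfl
    simp at this
    linarith
  -- the whole chain is the image of the hull of `L` and `(1 / v, 0)`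
  have hhull : convexHull ℝ (insert (v, u) (f '' W ∪ D) ∪ corners)
      = f '' convexHull ℝ (insert (1 / v, 0) L) := by
    rw [f.image_convexHull, Set.image_insert_eq, fc, hL, f.image_convexHull]
    apply Set.Subset.antisymm
    · have m0 : ((1, 0) : ℝ × ℝ) ∈ convexHull ℝ (insert ((1, 0) : ℝ × ℝ)
          (convexHull ℝ (f '' (W ∪ corners)))) := subset_convexHull ℝ _ (Set.mem_insert _ _)
      have m1 : f '' (W ∪ corners) ⊆ convexHull ℝ (insert ((1, 0) : ℝ × ℝ)
          (convexHull ℝ (f '' (W ∪ corners)))) := (subset_convexHull ℝ _).trans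
            ((Set.subset_insert _ _).trans (subset_convexHull ℝ _))
      have m2 := m1 ⟨(1, 0), Or.inr (by simp [corners]), f10⟩
      have m3 := m1 ⟨(0, 1), Or.inr (by simp [corners]), f01⟩
      refine convexHull_min ?_ (convex_convexHull ℝ _)
      rintro p ((rfl | hp | hp) | rfl | rfl)
      · exact m2
      · exact m1 (Set.image_mono Set.subset_union_left hp)
      · refine convexHull_min ?_ (convex_convexHull ℝ _) (hD hp)
        rintro q (rfl | rfl | rfl)
        exacts [m2, m0, m3]
      · exact m3
      · exact m0
    · refine convexHull_min ?_ (convex_convexHull ℝ _)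
      rintro p (rfl | hp)
      · exact subset_convexHull ℝ _ (Or.inr (by simp [corners]))
      · refine convexHull_mono ?_ hp
        rintro _ ⟨q, hq | rfl | rfl, rfl⟩
        · exact Or.inl (Or.inr (Or.inl ⟨q, hq, rfl⟩))
        · rw [f01]; exact Or.inr (by simp [corners])
        · rw [f10]; exact Or.inl (Or.inl rfl)
  have hext : (convexHull ℝ (insert ((1 / v, 0) : ℝ × ℝ) L)).extremePoints ℝ \
      {(0, 1), (1 / v, 0)} = insert (1, 0) (L.extremePoints ℝ \ corners) := by
    have h10 : ((1, 0) : ℝ × ℝ) ∈ L.extremePoints ℝ := by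
      refine ⟨hcorL (by simp [corners]), fun x hx y hy hxy => ?_⟩
      obtain ⟨s, t, hs, ht, hst, hxy⟩ := hxy
      have hx2 := (triangle_eq ▸ hLT hx : x ∈ {p : ℝ × ℝ | 0 ≤ p.1 ∧ 0 ≤ p.2 ∧ p.1 + p.2 ≤ 1}).2.1
      have hy2 := (triangle_eq ▸ hLT hy : y ∈ {p : ℝ × ℝ | 0 ≤ p.1 ∧ 0 ≤ p.2 ∧ p.1 + p.2 ≤ 1}).2.1
      apply hax x hx
      have := congrArg Prod.snd hxy
      simp at this
      have a1 := mul_nonneg ht.le hy2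
      have a2 : s * x.2 = 0 := le_antisymm (by linarith) (mul_nonneg hs.le hx2)
      exact (mul_eq_zero.1 a2).resolve_left hs.ne'
    ext p
    constructor
    · rintro ⟨hp, hp'⟩
      simp only [Set.mem_insert_iff, Set.mem_singleton_iff, not_or] at hp'
      have hpL : p ∈ L := (extremePoints_convexHull_subset hp).resolve_left hp'.2
      have hpe : p ∈ L.extremePoints ℝ :=
        inter_extremePoints_subset_extremePoints_of_subset
          ((Set.subset_insert _ _).trans (subset_convexHull ℝ _)) ⟨hpL, hp⟩
      by_cases h : p = (1, 0)
      · exact Or.inl h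
      · exact Or.inr ⟨hpe, by simp [corners, hp'.1, h]⟩
    · have key : ∀ q ∈ L.extremePoints ℝ, q ≠ (0, 1) →
          q ∈ (convexHull ℝ (insert ((1 / v, 0) : ℝ × ℝ) L)).extremePoints ℝ \
          {(0, 1), (1 / v, 0)} := by
        intro q hq h
        refine ⟨mem_extremePoints_insert (convex_convexHull ℝ _) hLT hcorL hax hc hq, ?_⟩
        rintro (h' | h')
        · exact h h'
        · rw [h'] at hq
          exact hcL hq.1
      rintro (rfl | ⟨hp, hp'⟩)
      · exact key _ h10 (by simp)
      · exact key p hp fun h => hp' (by simp [corners, h])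
  have hcor : corners = f '' {(0, 1), (1 / v, 0)} := by
    rw [Set.image_pair, f01, fc]; rfl
  unfold vertexNumber
  have hfin : (L.extremePoints ℝ \ corners).Finite := by
    apply Set.Finite.subset (s := W ∪ corners)
    · exact hWf.union (by simp [corners])
    · exact Set.sdiff_subset.trans extremePoints_convexHull_subset
  rw [hhull, extremePoints_image hinj, hcor, ← Set.image_sdiff hinj,
    Set.ncard_image_of_injective _ hinj, hext, ← hcor, Set.ncard_insert_of_notMem _ hfin]
  simp [corners]

/-! ### Measurability of the number of vertices -/

lemma convexHull_range_eq {E κ : Type*} [AddCommGroup E] [Module ℝ E] [Fintype κ] (z : κ → E) :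
    convexHull ℝ (Set.range z) = {p | ∃ w ∈ stdSimplex ℝ κ, ∑ i, w i • z i = p} := by
  classical
  apply Set.Subset.antisymm
  · apply convexHull_min
    · rintro _ ⟨i, rfl⟩
      refine ⟨Pi.single i 1, single_mem_stdSimplex ℝ i, ?_⟩
      rw [Finset.sum_eq_single i] <;> simp +contextual
    · rintro _ ⟨w, hw, rfl⟩ _ ⟨w', hw', rfl⟩ a b ha hb hab
      refine ⟨a • w + b • w', convex_stdSimplex ℝ κ hw hw' ha hb hab, ?_⟩
      simp [add_smul, Finset.sum_add_distrib, Finset.smul_sum, mul_smul]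
  · rintro _ ⟨w, hw, rfl⟩
    exact mem_convexHull_of_exists_fintype w z hw.1 hw.2 (fun i => ⟨i, rfl⟩) rfl

lemma isClosed_mem_convexHull_range {E X κ : Type*} [AddCommGroup E] [Module ℝ E]
    [TopologicalSpace E] [IsTopologicalAddGroup E] [ContinuousSMul ℝ E] [T2Space E]
    [TopologicalSpace X] [Fintype κ] {z₀ : X → E} {z : κ → X → E} (h₀ : Continuous z₀)
    (h : ∀ i, Continuous (z i)) :
    IsClosed {x | z₀ x ∈ convexHull ℝ (Set.range fun i => z i x)} := by
  have : {x | z₀ x ∈ convexHull ℝ (Set.range fun i => z i x)}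
      = Prod.snd '' {p : stdSimplex ℝ κ × X | ∑ i, p.1.1 i • z i p.2 = z₀ p.2} := by
    ext x
    simp [convexHull_range_eq]
  rw [this]
  refine isClosedMap_snd_of_compactSpace _ (isClosed_eq ?_ (by fun_prop))
  refine continuous_finsetSum _ fun i _ => Continuous.smul ?_ (by fun_prop)
  exact (continuous_apply i).comp (continuous_subtype_val.comp continuous_fst)

lemma mem_extremePoints_convexHull_iff {F : Set (ℝ × ℝ)} (hF : F.Finite) {p : ℝ × ℝ}
    (hp : p ∈ F) : p ∈ (convexHull ℝ F).extremePoints ℝ ↔ p ∉ convexHull ℝ (F \ {p}) := by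
  constructor
  · intro h
    have := ((convex_convexHull ℝ F).mem_extremePoints_iff_mem_sdiff_convexHull_sdiff.1 h).2
    exact fun h' => this (convexHull_mono (Set.sdiff_subset_sdiff_left (subset_convexHull ℝ F)) h')
  · -- otherwise all extreme points lie in `F \ {p}`, and Krein-Milman applies
    contrapose!
    intro h
    have hsub : (convexHull ℝ F).extremePoints ℝ ⊆ F \ {p} := fun q hq =>
      ⟨extremePoints_convexHull_subset hq, fun hqp => h (hqp ▸ hq)⟩
    have hKM := closure_convexHull_extremePoints (hF.isCompact_convexHull ℝ) (convex_convexHull ℝ F)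
    have hcl : IsClosed (convexHull ℝ (F \ {p})) :=
      (hF.subset Set.sdiff_subset).isClosed_convexHull ℝ
    have : convexHull ℝ F ⊆ convexHull ℝ (F \ {p}) := by
      rw [← hKM]
      exact closure_minimal (convexHull_mono hsub) hcl
    exact this (subset_convexHull ℝ F hp)

lemma measurableSet_isVertex {n : ℕ} (i : Fin n) :
    MeasurableSet {x : Fin n → ℝ × ℝ |
      x i ∈ (convexHull ℝ (Set.range x ∪ corners)).extremePoints ℝ ∧ x i ∉ corners} := by
  classical
  have hcor : MeasurableSet {x : Fin n → ℝ × ℝ | x i ∈ corners} :=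
    measurable_pi_apply i (by simp [corners] : corners.Finite).measurableSet
  -- for a non-corner `x i`, the points other than `x i` are the `x j` with `x j ≠ x i` and
  -- the two corners
  have key : {x : Fin n → ℝ × ℝ |
      x i ∈ (convexHull ℝ (Set.range x ∪ corners)).extremePoints ℝ ∧ x i ∉ corners}
      = {x : Fin n → ℝ × ℝ | x i ∈ corners}ᶜ \ ⋃ J : Finset (Fin n),
        ((⋂ j ∈ J, {x : Fin n → ℝ × ℝ | x j = x i}ᶜ) ∩
          {x | x i ∈ convexHull ℝ (Set.range (Sum.elim (fun j : J => x j)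
            (fun c : corners => c.1)))}) := by
    ext x
    simp only [Set.mem_ofPred_eq, Set.mem_sdiff, Set.mem_compl_iff, Set.mem_iUnion, Set.mem_inter_iff,
      Set.mem_iInter, not_exists, not_and, Set.Sum.elim_range, Subtype.range_coe]
    rw [and_comm]
    refine and_congr_right fun hx => ?_
    rw [mem_extremePoints_convexHull_iff ((Set.finite_range x).union (by simp [corners]))
      (Or.inl ⟨i, rfl⟩)]
    constructor
    · intro h J hJ h'
      refine h (convexHull_mono ?_ h')
      rintro _ (⟨j, rfl⟩ | hc)
      · exact ⟨Or.inl ⟨j, rfl⟩, hJ j j.2⟩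
      · exact ⟨Or.inr hc, fun h => hx (h ▸ hc)⟩
    · intro h h'
      refine h {j | x j ≠ x i} (by simp) (convexHull_mono ?_ h')
      rintro _ ⟨⟨j, rfl⟩ | hc, hne⟩
      · exact Or.inl ⟨⟨j, by simpa using hne⟩, rfl⟩
      · exact Or.inr hc
  rw [key]
  have : Fintype corners := (by simp [corners] : corners.Finite).fintype
  refine hcor.compl.diff (MeasurableSet.iUnion fun J => MeasurableSet.inter ?_ ?_)
  · exact MeasurableSet.biInter J.countable_toSet fun j _ =>
      (measurableSet_eq_fun (measurable_pi_apply j) (measurable_pi_apply i)).compl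
  · have e : ∀ x : Fin n → ℝ × ℝ, Sum.elim (fun j : J => x j) (fun c : corners => c.1)
        = fun k => (Sum.elim (fun (j : J) (x : Fin n → ℝ × ℝ) => x j)
          (fun (c : corners) _ => c.1) k) x := by
      intro x; ext k <;> rcases k with k | k <;> rfl
    simp_rw [e]
    refine (isClosed_mem_convexHull_range (continuous_apply i) ?_).measurableSet
    rintro (k | k)
    · exact continuous_apply (k : Fin n)
    · exact continuous_const

lemma measurable_vertexNumber_range (n : ℕ) :
    Measurable fun x : Fin n → ℝ × ℝ => vertexNumber (Set.range x) := by
  classical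
  -- a vertex that is attained several times is counted at its first index only
  have key : (fun x : Fin n → ℝ × ℝ => vertexNumber (Set.range x)) = fun x => ∑ i : Fin n,
      if (x i ∈ (convexHull ℝ (Set.range x ∪ corners)).extremePoints ℝ ∧ x i ∉ corners) ∧
        ∀ j < i, x j ≠ x i then 1 else 0 := by
    ext x
    rw [Finset.sum_boole, Nat.cast_id, vertexNumber, ← Set.ncard_coe_finset]
    symm
    refine Set.ncard_congr (fun i _ => x i) ?_ ?_ ?_
    · intro i hi
      simp only [Finset.coe_filter, Finset.mem_univ, true_and, Set.mem_ofPred_eq] at hi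
      exact hi.1
    · intro i j hi hj hij
      simp only [Finset.coe_filter, Finset.mem_univ, true_and, Set.mem_ofPred_eq] at hi hj
      rcases lt_trichotomy i j with h | h | h
      · exact absurd hij (hj.2 i h)
      · exact h
      · exact absurd hij.symm (hi.2 j h)
    · rintro p ⟨hp, hc⟩
      obtain ⟨i, hi⟩ := (extremePoints_convexHull_subset hp).resolve_right hc
      have hex : ∃ i, x i = p := ⟨i, hi⟩
      obtain ⟨m, hm, hmin⟩ := exists_minimal_of_wellFoundedLT (fun i => x i = p) hex
      refine ⟨m, ?_, hm⟩
      simp only [Finset.coe_filter, Finset.mem_univ, true_and, Set.mem_ofPred_eq]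
      exact ⟨by rw [hm]; exact ⟨hp, hc⟩, fun j hj h => absurd (hmin (h.trans hm) hj.le) hj.not_ge⟩
  rw [key]
  refine Finset.measurable_fun_sum _ fun i _ => Measurable.ite ?_ measurable_const measurable_const
  refine (measurableSet_isVertex i).inter ?_
  have : {x : Fin n → ℝ × ℝ | ∀ j < i, x j ≠ x i} = ⋂ j, ⋂ (_ : j < i), {x | x j = x i}ᶜ := by
    ext; simp
  change MeasurableSet {x : Fin n → ℝ × ℝ | ∀ j < i, x j ≠ x i}
  rw [this]
  exact MeasurableSet.iInter fun j => MeasurableSet.iInter fun _ =>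
    (measurableSet_eq_fun (measurable_pi_apply j) (measurable_pi_apply i)).compl

/-! ### The uniform distribution and its images under affine maps -/

/-- The open triangle with vertices `(0,0)`, `(0,1)`, `(1,0)`. -/
def openTriangle : Set (ℝ × ℝ) := {p | 0 < p.1 ∧ 0 < p.2 ∧ p.1 + p.2 < 1}

lemma measurableSet_openTriangle : MeasurableSet openTriangle :=
  (((isOpen_lt continuous_const continuous_fst).inter
    ((isOpen_lt continuous_const continuous_snd).inter
      (isOpen_lt (continuous_fst.add continuous_snd) continuous_const)))).measurableSet

lemma openTriangle_subset_triangle : openTriangle ⊆ triangle := by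
  rw [triangle_eq]
  exact fun p hp => ⟨hp.1.le, hp.2.1.le, hp.2.2.le⟩

lemma volume_line_eq_zero {a b c : ℝ} (h : a ≠ 0 ∨ b ≠ 0) :
    volume {p : ℝ × ℝ | a * p.1 + b * p.2 = c} = 0 := by
  have hm : MeasurableSet {p : ℝ × ℝ | a * p.1 + b * p.2 = c} :=
    measurableSet_eq_fun (by fun_prop) (by fun_prop)
  by_cases hb : b = 0
  · subst hb
    have ha : a ≠ 0 := by simpa using h
    have : {p : ℝ × ℝ | a * p.1 + 0 * p.2 = c} = {c / a} ×ˢ Set.univ := by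
      ext p
      simp only [Set.mem_ofPred_eq, Set.mem_prod, Set.mem_singleton_iff, Set.mem_univ, and_true]
      rw [eq_div_iff ha]
      constructor <;> intro h <;> linarith
    rw [this, Measure.volume_eq_prod, Measure.prod_prod]
    simp
  · rw [Measure.volume_eq_prod, Measure.measure_prod_null hm]
    refine Filter.Eventually.of_forall fun x => ?_
    have : Prod.mk x ⁻¹' {p : ℝ × ℝ | a * p.1 + b * p.2 = c} ⊆ {(c - a * x) / b} := by
      intro y hy
      simp only [Set.mem_preimage, Set.mem_ofPred_eq] at hy
      rw [Set.mem_singleton_iff, eq_div_iff hb]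
      linarith
    exact measure_mono_null this (by simp)

lemma triangle_ae_eq : triangle =ᵐ[volume] openTriangle := by
  apply Filter.EventuallyLE.antisymm _ (openTriangle_subset_triangle.eventuallyLE)
  rw [ae_le_set]
  have : triangle \ openTriangle ⊆ {p : ℝ × ℝ | 1 * p.1 + 0 * p.2 = 0} ∪
      ({p : ℝ × ℝ | 0 * p.1 + 1 * p.2 = 0} ∪ {p : ℝ × ℝ | 1 * p.1 + 1 * p.2 = 1}) := by
    rintro p ⟨hp, hp'⟩
    rw [triangle_eq] at hp
    by_contra h
    simp only [Set.mem_union, Set.mem_ofPred_eq, not_or] at h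
    refine hp' ⟨lt_of_le_of_ne hp.1 fun e => h.1 ?_, lt_of_le_of_ne hp.2.1 fun e => h.2.1 ?_,
      lt_of_le_of_ne hp.2.2 fun e => h.2.2 ?_⟩ <;> linarith
  refine measure_mono_null this ?_
  rw [measure_union_null_iff, measure_union_null_iff]
  exact ⟨volume_line_eq_zero (by simp), volume_line_eq_zero (by simp),
    volume_line_eq_zero (by simp)⟩

lemma volume_openTriangle : volume openTriangle = ENNReal.ofReal (1 / 2) := by
  have : openTriangle = regionBetween (fun _ => 0) (fun x => 1 - x) (Set.Ioo 0 1) := by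
    ext p
    simp only [openTriangle, regionBetween, Set.mem_ofPred_eq, Set.mem_Ioo]
    constructor
    · rintro ⟨h1, h2, h3⟩; exact ⟨⟨h1, by linarith⟩, h2, by linarith⟩
    · rintro ⟨⟨h1, h2⟩, h3, h4⟩; exact ⟨h1, h3, by linarith⟩
  rw [this, Measure.volume_eq_prod, volume_regionBetween_eq_integral]
  · rw [← integral_Ioc_eq_integral_Ioo, ← intervalIntegral.integral_of_le zero_le_one]
    congr 1
    simp only [Pi.sub_apply, sub_zero]
    rw [intervalIntegral.integral_sub (by simp) (by simp)]
    simp; norm_num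
  · exact integrableOn_zero
  · exact (Continuous.integrableOn_Icc (by fun_prop)).mono_set Set.Ioo_subset_Icc_self
  · exact measurableSet_Ioo
  · intro x hx; linarith [hx.2]

lemma uniformTriangle_eq :
    uniformTriangle = (2 : ENNReal) • volume.restrict openTriangle := by
  rw [uniformTriangle, ProbabilityTheory.cond, measure_congr triangle_ae_eq,
    Measure.restrict_congr_set triangle_ae_eq, volume_openTriangle]
  congr 1
  rw [← ENNReal.ofReal_inv_of_pos (by norm_num)]
  norm_num

instance : IsProbabilityMeasure uniformTriangle := by
  constructor
  rw [uniformTriangle_eq]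
  simp only [Measure.smul_apply, Measure.restrict_apply_univ, volume_openTriangle, smul_eq_mul]
  rw [show (2 : ENNReal) = ENNReal.ofReal 2 by simp, ← ENNReal.ofReal_mul (by norm_num)]
  norm_num

lemma ae_mem_openTriangle : ∀ᵐ p ∂uniformTriangle, p ∈ openTriangle := by
  rw [uniformTriangle_eq]
  exact Measure.ae_smul_measure (ae_restrict_mem measurableSet_openTriangle) _

lemma ae_notMem_line {a b c : ℝ} (h : a ≠ 0 ∨ b ≠ 0) :
    ∀ᵐ p ∂uniformTriangle, a * p.1 + b * p.2 ≠ c := by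
  rw [uniformTriangle_eq]
  refine Measure.ae_smul_measure (ae_restrict_of_ae ?_) _
  exact measure_eq_zero_iff_ae_notMem.1 (volume_line_eq_zero h)

/-- The cross product of two vectors of the plane. -/
def cross (p q : ℝ × ℝ) : ℝ := p.1 * q.2 - p.2 * q.1

lemma mem_image_triMap_iff {a b c : ℝ × ℝ} (h : 0 < cross (b - a) (c - a)) {p : ℝ × ℝ} :
    p ∈ triMap a b c '' openTriangle ↔ 0 < cross (p - a) (c - a) ∧ 0 < cross (b - a) (p - a) ∧
      cross (p - a) (c - a) + cross (b - a) (p - a) < cross (b - a) (c - a) := by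
  constructor
  · rintro ⟨⟨x, y⟩, ⟨h1, h2, h3⟩, rfl⟩
    simp only at h1 h2 h3
    have e1 : cross (triMap a b c (x, y) - a) (c - a) = x * cross (b - a) (c - a) := by
      simp [triMap_apply, cross]; ring
    have e2 : cross (b - a) (triMap a b c (x, y) - a) = y * cross (b - a) (c - a) := by
      simp [triMap_apply, cross]; ring
    rw [e1, e2]
    exact ⟨by positivity, by positivity, by nlinarith⟩
  · rintro ⟨h1, h2, h3⟩
    refine ⟨(cross (p - a) (c - a) / cross (b - a) (c - a),
      cross (b - a) (p - a) / cross (b - a) (c - a)), ⟨by positivity, by positivity, ?_⟩, ?_⟩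
    · rw [← add_div, div_lt_one h]; exact h3
    · have hd := h.ne'
      rw [triMap_apply]
      ext
      · simp only [Prod.fst_add, Prod.smul_fst, smul_eq_mul]
        field_simp
        simp only [cross, Prod.fst_sub, Prod.snd_sub]
        ring
      · simp only [Prod.snd_add, Prod.smul_snd, smul_eq_mul]
        field_simp
        simp only [cross, Prod.fst_sub, Prod.snd_sub]
        ring

lemma triMap_injective {a b c : ℝ × ℝ} (h : cross (b - a) (c - a) ≠ 0) :
    Function.Injective (triMap a b c) := by
  intro p q hpq
  have e1 : ∀ p, cross (triMap a b c p - a) (c - a) = p.1 * cross (b - a) (c - a) := by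
    intro p; simp [triMap_apply, cross]; ring
  have e2 : ∀ p, cross (b - a) (triMap a b c p - a) = p.2 * cross (b - a) (c - a) := by
    intro p; simp [triMap_apply, cross]; ring
  ext
  · exact mul_right_cancel₀ h (by rw [← e1, ← e1, hpq])
  · exact mul_right_cancel₀ h (by rw [← e2, ← e2, hpq])

lemma continuous_triMap (a b c : ℝ × ℝ) : Continuous (triMap a b c) := by
  change Continuous fun p : ℝ × ℝ => a + p.1 • (b - a) + p.2 • (c - a)
  fun_prop

lemma measurableEmbedding_triMap {a b c : ℝ × ℝ} (h : cross (b - a) (c - a) ≠ 0) :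
    MeasurableEmbedding (triMap a b c) :=
  (continuous_triMap a b c).measurableEmbedding (triMap_injective h)

lemma map_triMap_volume {a b c : ℝ × ℝ} (h : 0 < cross (b - a) (c - a)) :
    Measure.map (triMap a b c) volume
      = ENNReal.ofReal (cross (b - a) (c - a))⁻¹ • (volume : Measure (ℝ × ℝ)) := by
  set A : (ℝ × ℝ) →ₗ[ℝ] (ℝ × ℝ) := Matrix.toLin (Module.Basis.finTwoProd ℝ)
    (Module.Basis.finTwoProd ℝ) !![(b - a).1, (c - a).1; (b - a).2, (c - a).2] with hA
  have hdet : LinearMap.det A = cross (b - a) (c - a) := by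
    rw [hA, LinearMap.det_toLin, Matrix.det_fin_two_of, cross]; ring
  have hcomp : (triMap a b c : ℝ × ℝ → ℝ × ℝ) = (fun p => a + p) ∘ A := by
    ext p <;> simp [triMap_apply, hA, Matrix.toLin_finTwoProd_apply] <;> ring
  rw [hcomp, ← Measure.map_map (by fun_prop) (LinearMap.continuous_of_finiteDimensional A).measurable,
    Measure.map_linearMap_addHaar_eq_smul_addHaar volume (by rw [hdet]; exact h.ne'), hdet,
    Measure.map_smul, map_add_left_eq_self, abs_of_pos (inv_pos.2 h)]

/-- Inside the image of the open triangle under an affine map that stays in the triangle, the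
uniform distribution is the image of the uniform distribution times the ratio of the areas. -/
lemma uniformTriangle_restrict_image {a b c : ℝ × ℝ} (h : 0 < cross (b - a) (c - a))
    (hsub : triMap a b c '' openTriangle ⊆ openTriangle) :
    uniformTriangle.restrict (triMap a b c '' openTriangle)
      = ENNReal.ofReal (cross (b - a) (c - a)) • Measure.map (triMap a b c) uniformTriangle := by
  have hm : MeasurableSet (triMap a b c '' openTriangle) :=
    (measurableEmbedding_triMap h.ne').measurableSet_image.2 measurableSet_openTriangle
  have key := (measurableEmbedding_triMap h.ne').restrict_map volume
    (triMap a b c '' openTriangle)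
  rw [Set.preimage_image_eq _ (triMap_injective h.ne'), map_triMap_volume h,
    Measure.restrict_smul] at key
  rw [uniformTriangle_eq, Measure.restrict_smul, Measure.restrict_restrict hm,
    Set.inter_eq_left.2 hsub, Measure.map_smul, ← key, smul_comm, smul_smul, smul_smul,
    mul_assoc, ← ENNReal.ofReal_mul h.le, mul_inv_cancel₀ h.ne']
  simp

/-! ### The law of the remaining points given the last vertex -/

/-- The point `p` lies strictly above the line through `V` and the corner `(1,0)`. -/
def Above (V p : ℝ × ℝ) : Prop := V.2 * (1 - p.1) < p.2 * (1 - V.1)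

/-- The affine map onto the triangle with vertices `V`, `(0,1)` and the point where the line through
`(1,0)` and `V` meets the vertical axis. It sends the corners `(1,0)` and `(0,1)` to `V` and
`(0,1)`. -/
noncomputable abbrev upperMap (V : ℝ × ℝ) : (ℝ × ℝ) →ᵃ[ℝ] (ℝ × ℝ) :=
  triMap (0, V.2 / (1 - V.1)) V (0, 1)

/-- The affine map onto the triangle with vertices `V` and the two corners. -/
noncomputable abbrev lowerMap (V : ℝ × ℝ) : (ℝ × ℝ) →ᵃ[ℝ] (ℝ × ℝ) :=
  triMap V (1, 0) (0, 1)

/-- The ratio of the area of the upper triangle of `V` to the area of the whole triangle. -/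
noncomputable def upperArea (V : ℝ × ℝ) : ℝ := V.1 * (1 - V.2 / (1 - V.1))

/-- The ratio of the area of the lower triangle of `V` to the area of the whole triangle. -/
def lowerArea (V : ℝ × ℝ) : ℝ := 1 - V.1 - V.2

lemma cross_upper (V : ℝ × ℝ) :
    cross (V - (0, V.2 / (1 - V.1))) ((0, 1) - (0, V.2 / (1 - V.1))) = upperArea V := by
  simp [cross, upperArea]

lemma cross_lower (V : ℝ × ℝ) : cross ((1, 0) - V) ((0, 1) - V) = lowerArea V := by
  simp [cross, lowerArea]; ring

lemma lowerArea_pos {V : ℝ × ℝ} (hV : V ∈ openTriangle) : 0 < lowerArea V := by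
  have := hV.2.2
  unfold lowerArea; linarith

lemma upperArea_pos {V : ℝ × ℝ} (hV : V ∈ openTriangle) : 0 < upperArea V := by
  obtain ⟨h1, h2, h3⟩ := hV
  have : V.2 / (1 - V.1) < 1 := by rw [div_lt_one] <;> linarith
  exact mul_pos h1 (by linarith)

lemma upperMap_mem {V : ℝ × ℝ} (hV : V ∈ openTriangle) {p : ℝ × ℝ}
    (hp : p ∈ upperMap V '' openTriangle) :
    p ∈ openTriangle ∧ Above V p ∧ p.1 * (1 - V.2) < (1 - p.2) * V.1 := by
  obtain ⟨w, ⟨h1, h2, h3⟩, rfl⟩ := hp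
  obtain ⟨v1, v2, v3⟩ := hV
  have hv : 0 < 1 - V.1 := by linarith
  obtain ⟨β, hβ⟩ : ∃ β, β = V.2 / (1 - V.1) := ⟨_, rfl⟩
  have hβ1 : β < 1 := by rw [hβ, div_lt_one] <;> linarith
  have hβ0 : 0 < β := by rw [hβ]; positivity
  have hβe : β * (1 - V.1) = V.2 := by rw [hβ]; field_simp
  rw [triMap_apply, ← hβ]
  simp only [openTriangle, Above, Set.mem_ofPred_eq, Prod.fst_add, Prod.snd_add, Prod.smul_fst,
    Prod.smul_snd, Prod.fst_sub, Prod.snd_sub, smul_eq_mul]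
  have w3 : 0 < 1 - w.1 - w.2 := by linarith
  have a1 := mul_pos h1 v1
  have a2 := mul_pos h1 v2
  have a3 := mul_pos w3 hβ0
  have a4 := mul_pos w3 (sub_pos.2 hβ1)
  refine ⟨⟨by linarith, by linarith, ?_⟩, ?_, ?_⟩
  · have : 0 < w.1 * (1 - V.1 - V.2) := mul_pos h1 (by linarith)
    linarith
  · have : 0 < w.2 * (1 - V.1 - V.2) := mul_pos h2 (by linarith)
    linear_combination this + (w.1 + w.2 - 1) * hβe
  · have := mul_pos a4 v1
    linear_combination this

lemma lowerMap_mem {V : ℝ × ℝ} (hV : V ∈ openTriangle) {p : ℝ × ℝ}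
    (hp : p ∈ lowerMap V '' openTriangle) :
    p ∈ openTriangle ∧ Above V p ∧ (1 - p.2) * V.1 < p.1 * (1 - V.2) := by
  obtain ⟨w, ⟨h1, h2, h3⟩, rfl⟩ := hp
  obtain ⟨v1, v2, v3⟩ := hV
  rw [triMap_apply]
  simp only [openTriangle, Above, Set.mem_ofPred_eq, Prod.fst_add, Prod.snd_add, Prod.smul_fst,
    Prod.smul_snd, Prod.fst_sub, Prod.snd_sub, smul_eq_mul]
  have w3 : 0 < 1 - w.1 - w.2 := by linarith
  have v3' : 0 < 1 - V.1 - V.2 := by linarith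
  have a1 := mul_pos w3 v1
  have a2 := mul_pos w3 v2
  have a3 := mul_pos w3 v3'
  refine ⟨⟨by linarith, by linarith, by linarith⟩, ?_, ?_⟩
  · have := mul_pos h2 v3'
    linarith
  · have := mul_pos h1 v3'
    linarith

lemma mem_upperMap {V : ℝ × ℝ} (hV : V ∈ openTriangle) {p : ℝ × ℝ} (hp : p ∈ openTriangle)
    (h : Above V p) (hs : p.1 * (1 - V.2) < (1 - p.2) * V.1) :
    p ∈ upperMap V '' openTriangle := by
  have hU := upperArea_pos hV
  rw [← cross_upper] at hU
  rw [upperMap, mem_image_triMap_iff hU]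
  obtain ⟨v1, v2, v3⟩ := hV
  obtain ⟨p1, p2, p3⟩ := hp
  have hv : 0 < 1 - V.1 := by linarith
  obtain ⟨β, hβ⟩ : ∃ β, β = V.2 / (1 - V.1) := ⟨_, rfl⟩
  have hβ1 : β < 1 := by rw [hβ, div_lt_one] <;> linarith
  have hβe : β * (1 - V.1) = V.2 := by rw [hβ]; field_simp
  unfold Above at h
  simp only [cross, Prod.fst_sub, Prod.snd_sub, ← hβ]
  refine ⟨?_, ?_, ?_⟩
  · have := mul_pos p1 (sub_pos.2 hβ1); linarith
  · refine pos_of_mul_pos_left (b := 1 - V.1) ?_ hv.le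
    have := mul_pos v1 (sub_pos.2 h)
    linear_combination this - (p.1 - V.1) * hβe
  · linear_combination hs

lemma mem_lowerMap {V : ℝ × ℝ} (hV : V ∈ openTriangle) {p : ℝ × ℝ} (hp : p ∈ openTriangle)
    (h : Above V p) (hs : (1 - p.2) * V.1 < p.1 * (1 - V.2)) :
    p ∈ lowerMap V '' openTriangle := by
  have hL := lowerArea_pos hV
  rw [← cross_lower] at hL
  rw [lowerMap, mem_image_triMap_iff hL]
  obtain ⟨p1, p2, p3⟩ := hp
  unfold Above at h
  simp only [cross, Prod.fst_sub, Prod.snd_sub]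
  refine ⟨?_, ?_, ?_⟩ <;> linarith

lemma lowerMap_image_subset (V : ℝ × ℝ) :
    lowerMap V '' openTriangle ⊆ convexHull ℝ {V, (1, 0), (0, 1)} := by
  have e : lowerMap V '' triangle = convexHull ℝ {V, (0, 1), (1, 0)} := by
    rw [triangle, AffineMap.image_convexHull]
    simp [Set.image_insert_eq, triMap_apply]
  rw [Set.pair_comm, ← e]
  exact Set.image_mono openTriangle_subset_triangle

lemma vertexNumber_upper {V : ℝ × ℝ} (hV : V ∈ openTriangle) {W D : Set (ℝ × ℝ)}
    (hWf : W.Finite) (hW : W ⊆ openTriangle) (hD : D ⊆ lowerMap V '' openTriangle) :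
    vertexNumber (insert V (upperMap V '' W ∪ D)) = vertexNumber W + 1 :=
  vertexNumber_insert hV.1 hV.2.2 hWf (hW.trans openTriangle_subset_triangle)
    (fun _ hw => (hW hw).2.1) (hD.trans (lowerMap_image_subset V)) hV.2.1.le

lemma vertexNumber_union_lower {V : ℝ × ℝ} (hV : V ∈ openTriangle) {P D : Set (ℝ × ℝ)}
    (hPf : P.Finite) (hP : P ⊆ upperMap V '' openTriangle)
    (hD : D ⊆ lowerMap V '' openTriangle) :
    vertexNumber (insert V (P ∪ D)) = vertexNumber (insert V P) := by
  obtain ⟨W, hW, rfl⟩ := Set.subset_image_iff.1 hP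
  have hinj : Function.Injective (upperMap V) :=
    triMap_injective (by rw [cross_upper]; exact (upperArea_pos hV).ne')
  have hWf : W.Finite := hPf.of_finite_image hinj.injOn
  rw [vertexNumber_upper hV hWf hW hD, ← vertexNumber_upper hV hWf hW (Set.empty_subset _),
    Set.union_empty]

/-- The probability that the number of vertices plus one equals `k`. -/
noncomputable def shiftedLaw (n k : ℕ) : ENNReal :=
  sampleLaw n {x | vertexCount x + 1 = k}

lemma measurable_vertexNumber_insert {n : ℕ} :
    Measurable fun q : (ℝ × ℝ) × (Fin n → ℝ × ℝ) => vertexNumber (insert q.1 (Set.range q.2)) := by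
  have : (fun q : (ℝ × ℝ) × (Fin n → ℝ × ℝ) => vertexNumber (insert q.1 (Set.range q.2)))
      = (fun x : Fin (n + 1) → ℝ × ℝ => vertexNumber (Set.range x)) ∘
        (fun q => Fin.cons q.1 q.2) := by
    ext q
    simp [Fin.range_cons]
  rw [this]
  refine (measurable_vertexNumber_range (n + 1)).comp (measurable_pi_iff.2 fun i => ?_)
  refine Fin.cases ?_ (fun j => ?_) i
  · simpa using measurable_fst
  · simp only [Fin.cons_succ]
    exact (measurable_pi_apply j).comp measurable_snd

instance (n : ℕ) : IsProbabilityMeasure (sampleLaw n) := by unfold sampleLaw; infer_instance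

lemma ae_forall_sampleLaw {n : ℕ} {Q : ℝ × ℝ → Prop} (h : ∀ᵐ p ∂uniformTriangle, Q p) :
    ∀ᵐ x ∂sampleLaw n, ∀ i, Q (x i) :=
  Filter.eventually_all.2 fun _ => Measure.tendsto_eval_ae_ae.eventually h

lemma sampleLaw_upper {V : ℝ × ℝ} (hV : V ∈ openTriangle) (m k : ℕ) :
    sampleLaw m {w | Set.range w ⊆ upperMap V '' openTriangle ∧
      vertexNumber (insert V (Set.range w)) = k}
      = ENNReal.ofReal (upperArea V) ^ m * shiftedLaw m k := by
  set U := upperMap V '' openTriangle with hU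
  have hd : 0 < cross (V - (0, V.2 / (1 - V.1))) ((0, 1) - (0, V.2 / (1 - V.1))) := by
    rw [cross_upper]; exact upperArea_pos hV
  have hUm : MeasurableSet U :=
    (measurableEmbedding_triMap hd.ne').measurableSet_image.2 measurableSet_openTriangle
  have hB : MeasurableSet {w : Fin m → ℝ × ℝ | vertexNumber (insert V (Set.range w)) = k} :=
    (measurable_vertexNumber_insert.comp (measurable_const.prodMk measurable_id))
      (measurableSet_singleton k)
  have e1 : {w : Fin m → ℝ × ℝ | Set.range w ⊆ U ∧ vertexNumber (insert V (Set.range w)) = k}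
      = {w | vertexNumber (insert V (Set.range w)) = k} ∩ Set.univ.pi fun _ => U := by
    ext w
    simp [Set.range_subset_iff, and_comm]
  have hres : uniformTriangle.restrict U
      = ENNReal.ofReal (upperArea V) • Measure.map (upperMap V) uniformTriangle := by
    rw [← cross_upper]
    exact uniformTriangle_restrict_image hd fun p hp => (upperMap_mem hV hp).1
  have hprob : IsProbabilityMeasure (Measure.map (upperMap V) uniformTriangle) :=
    Measure.isProbabilityMeasure_map (continuous_triMap _ _ _).measurable.aemeasurable
  have hpi : (Measure.pi fun _ : Fin m => uniformTriangle.restrict U)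
      = ENNReal.ofReal (upperArea V) ^ m •
        Measure.map (fun (x : Fin m → ℝ × ℝ) i => upperMap V (x i)) (sampleLaw m) := by
    rw [sampleLaw, Measure.pi_map_pi (μ := fun _ : Fin m => uniformTriangle)
      (f := fun _ => upperMap V) fun _ => (continuous_triMap _ _ _).measurable.aemeasurable]
    refine Measure.pi_eq fun s _ => ?_
    simp only [hres, Measure.smul_apply, smul_eq_mul, Measure.pi_pi, Finset.prod_mul_distrib,
      Finset.prod_const, Finset.card_univ, Fintype.card_fin]
  have hmeas : Measurable fun (x : Fin m → ℝ × ℝ) i => upperMap V (x i) :=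
    measurable_pi_iff.2 fun i => (continuous_triMap _ _ _).measurable.comp (measurable_pi_apply i)
  rw [e1, ← Measure.restrict_apply hB, sampleLaw, Measure.restrict_pi_pi, hpi, Measure.smul_apply,
    smul_eq_mul, Measure.map_apply hmeas hB, shiftedLaw]
  congr 1
  refine measure_congr ?_
  filter_upwards [ae_forall_sampleLaw ae_mem_openTriangle] with x hx
  refine propext ?_
  change vertexNumber (insert V (Set.range fun i => upperMap V (x i))) = k ↔
    vertexNumber (Set.range x) + 1 = k
  have := vertexNumber_upper hV (Set.finite_range x) (Set.range_subset_iff.2 hx)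
    (Set.empty_subset _)
  rw [Set.union_empty, ← Set.range_comp] at this
  rw [← this]
  rfl

lemma pi_range_eq_sampleLaw {ι : Type*} {_ : Fintype ι} (Q : Set (ℝ × ℝ) → Prop) :
    (Measure.pi fun _ : ι => uniformTriangle) {w | Q (Set.range w)}
      = sampleLaw (Fintype.card ι) {x | Q (Set.range x)} := by
  have h := measurePreserving_piCongrLeft (fun _ : ι => uniformTriangle) (Fintype.equivFin ι).symm
  rw [← h.measure_preimage_equiv, sampleLaw]
  congr 1
  ext x
  have e : Set.range (MeasurableEquiv.piCongrLeft (fun _ : ι => ℝ × ℝ) (Fintype.equivFin ι).symm x)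
      = Set.range x := by
    rw [← (Fintype.equivFin ι).symm.surjective.range_comp]
    congr 1
    ext1 j
    exact Equiv.piCongrLeft_apply_apply (P := fun _ : ι => ℝ × ℝ) _ x j
  change Q _ ↔ Q _
  rw [e]

lemma uniformTriangle_lower {V : ℝ × ℝ} (hV : V ∈ openTriangle) :
    uniformTriangle (lowerMap V '' openTriangle) = ENNReal.ofReal (lowerArea V) := by
  have hd : 0 < cross ((1, 0) - V) ((0, 1) - V) := by
    rw [cross_lower]; exact lowerArea_pos hV
  have := uniformTriangle_restrict_image hd fun p hp => (lowerMap_mem hV hp).1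
  have h2 := congrArg (fun ν : Measure (ℝ × ℝ) => ν Set.univ) this
  simp only [Measure.restrict_apply_univ, Measure.smul_apply, smul_eq_mul] at h2
  rw [h2, Measure.map_apply (continuous_triMap _ _ _).measurable MeasurableSet.univ, cross_lower]
  simp

/-- The probability that `V` is the last vertex and that there are `k` vertices, decomposed
according to the set of points which lie in the upper triangle of `V`. -/
lemma sampleLaw_above {V : ℝ × ℝ} (hV : V ∈ openTriangle) (n k : ℕ) :
    sampleLaw n {y | (∀ j, Above V (y j)) ∧ vertexNumber (insert V (Set.range y)) = k}
      = ∑ S : Finset (Fin n), ENNReal.ofReal (upperArea V) ^ S.card * shiftedLaw S.card k *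
          ENNReal.ofReal (lowerArea V) ^ (n - S.card) := by
  classical
  set U := upperMap V '' openTriangle with hU
  set D := lowerMap V '' openTriangle with hD
  have hUm : MeasurableSet U := (measurableEmbedding_triMap
    (by rw [cross_upper]; exact (upperArea_pos hV).ne')).measurableSet_image.2
      measurableSet_openTriangle
  have hDm : MeasurableSet D := (measurableEmbedding_triMap
    (by rw [cross_lower]; exact (lowerArea_pos hV).ne')).measurableSet_image.2
      measurableSet_openTriangle
  have hdisj : ∀ p, p ∈ U → p ∉ D := fun p hp hp' =>
    lt_asymm (upperMap_mem hV hp).2.2 (lowerMap_mem hV hp').2.2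
  have hB : MeasurableSet {w : Fin n → ℝ × ℝ | vertexNumber (insert V (Set.range w)) = k} :=
    (measurable_vertexNumber_insert.comp (measurable_const.prodMk measurable_id))
      (measurableSet_singleton k)
  let E : Finset (Fin n) → Set (Fin n → ℝ × ℝ) := fun S =>
    (Set.univ.pi fun j => if j ∈ S then U else D) ∩
      {y | vertexNumber (insert V (Set.range y)) = k}
  have hEm : ∀ S, MeasurableSet (E S) := fun S =>
    (MeasurableSet.univ_pi fun j => by split_ifs <;> assumption).inter hB
  have hEd : Pairwise (Function.onFun Disjoint E) := by
    intro S S' hne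
    rw [Function.onFun, Set.disjoint_left]
    rintro y ⟨hy, -⟩ ⟨hy', -⟩
    apply hne
    ext j
    have h := hy j trivial
    have h' := hy' j trivial
    by_cases hj : j ∈ S <;> by_cases hj' : j ∈ S' <;> simp only [hj, hj', if_true, if_false] at h h' ⊢
    · exact absurd h' (hdisj _ h)
    · exact absurd h (hdisj _ h')
  have hae : {y | (∀ j, Above V (y j)) ∧ vertexNumber (insert V (Set.range y)) = k}
      =ᵐ[sampleLaw n] ⋃ S ∈ (Finset.univ : Finset (Finset (Fin n))), E S := by
    have hline := ae_notMem_line (a := 1 - V.2) (b := V.1) (c := V.1) (Or.inr hV.1.ne')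
    filter_upwards [ae_forall_sampleLaw ae_mem_openTriangle, ae_forall_sampleLaw hline]
      with y hy hy'
    refine propext ?_
    change ((∀ j, Above V (y j)) ∧ vertexNumber (insert V (Set.range y)) = k) ↔
      y ∈ ⋃ S ∈ (Finset.univ : Finset (Finset (Fin n))), E S
    simp only [Set.mem_iUnion]
    constructor
    · rintro ⟨ha, hk⟩
      refine ⟨Finset.univ.filter fun j => y j ∈ U, Finset.mem_univ _, fun j _ => ?_, hk⟩
      by_cases hj : y j ∈ U
      · simp [hj]
      · simp only [Finset.mem_filter, Finset.mem_univ, hj, and_false, if_false]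
        refine mem_lowerMap hV (hy j) (ha j) ?_
        have h1 : ¬ ((y j).1 * (1 - V.2) < (1 - (y j).2) * V.1) := fun h =>
          hj (mem_upperMap hV (hy j) (ha j) h)
        refine lt_of_le_of_ne (not_lt.1 h1) fun h => hy' j ?_
        linarith
    · rintro ⟨S, -, hS, hk⟩
      refine ⟨fun j => ?_, hk⟩
      have := hS j trivial
      by_cases hj : j ∈ S
      · simp only [hj, if_true] at this
        exact (upperMap_mem hV this).2.1
      · simp only [hj, if_false] at this
        exact (lowerMap_mem hV this).2.1
  rw [measure_congr hae, measure_biUnion_finset (fun S _ S' _ h => hEd h) fun S _ => hEm S]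
  refine Finset.sum_congr rfl fun S _ => ?_
  have hE : E S = MeasurableEquiv.piEquivPiSubtypeProd (fun _ : Fin n => ℝ × ℝ) (· ∈ S) ⁻¹'
      ({w | Set.range w ⊆ U ∧ vertexNumber (insert V (Set.range w)) = k} ×ˢ
        Set.univ.pi fun _ => D) := by
    ext y
    have hcount : (∀ j : {j // j ∈ S}, y j ∈ U) → (∀ j : {j // j ∉ S}, y j ∈ D) →
        vertexNumber (insert V (Set.range y))
          = vertexNumber (insert V (Set.range fun j : {j // j ∈ S} => y j)) := by
      intro h1 h2
      rw [← vertexNumber_union_lower hV (Set.finite_range fun j : {j // j ∈ S} => y j)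
        (Set.range_subset_iff.2 h1) (Set.range_subset_iff.2 h2)]
      congr 2
      ext p
      constructor
      · rintro ⟨j, rfl⟩
        by_cases hj : j ∈ S
        · exact Or.inl ⟨⟨j, hj⟩, rfl⟩
        · exact Or.inr ⟨⟨j, hj⟩, rfl⟩
      · rintro (⟨j, rfl⟩ | ⟨j, rfl⟩) <;> exact ⟨_, rfl⟩
    constructor
    · rintro ⟨hy, hk⟩
      have h1 : ∀ j : {j // j ∈ S}, y j ∈ U := fun j => by
        have := hy j trivial; simpa [j.2] using this
      have h2 : ∀ j : {j // j ∉ S}, y j ∈ D := fun j => by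
        have := hy j trivial; simpa [j.2] using this
      exact ⟨⟨Set.range_subset_iff.2 h1, (hcount h1 h2).symm.trans hk⟩, fun j _ => h2 j⟩
    · rintro ⟨⟨h1, hk⟩, h2⟩
      rw [Set.range_subset_iff] at h1
      have h2 : ∀ j : {j // j ∉ S}, y j ∈ D := fun j => h2 j trivial
      refine ⟨fun j _ => ?_, (hcount h1 h2).trans hk⟩
      by_cases hj : j ∈ S
      · simpa [hj] using h1 ⟨j, hj⟩
      · simpa [hj] using h2 ⟨j, hj⟩
  rw [hE, sampleLaw, (measurePreserving_piEquivPiSubtypeProd (fun _ : Fin n => uniformTriangle)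
    (· ∈ S)).measure_preimage_equiv, Measure.prod_prod, Measure.pi_pi,
    pi_range_eq_sampleLaw (fun P => P ⊆ U ∧ vertexNumber (insert V P) = k),
    sampleLaw_upper hV, Finset.prod_const, uniformTriangle_lower hV]
  simp [Fintype.card_subtype_compl]

/-! ### The recurrence for the vertex probabilities -/

lemma measurableSet_above_vertexNumber (n k : ℕ) :
    MeasurableSet {q : (ℝ × ℝ) × (Fin n → ℝ × ℝ) |
      (∀ j, Above q.1 (q.2 j)) ∧ vertexNumber (insert q.1 (Set.range q.2)) = k} := by
  refine MeasurableSet.inter ?_ (measurable_vertexNumber_insert (measurableSet_singleton k))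
  have : {q : (ℝ × ℝ) × (Fin n → ℝ × ℝ) | ∀ j, Above q.1 (q.2 j)}
      = ⋂ j, {q | q.1.2 * (1 - (q.2 j).1) < (q.2 j).2 * (1 - q.1.1)} := by
    ext; simp [Above]
  change MeasurableSet {q : (ℝ × ℝ) × (Fin n → ℝ × ℝ) | ∀ j, Above q.1 (q.2 j)}
  rw [this]
  exact MeasurableSet.iInter fun j => measurableSet_lt (by fun_prop) (by fun_prop)

/-- By symmetry, the last vertex may be taken to be the first point. -/
lemma sampleLaw_succ_eq_lintegral (n k : ℕ) :
    sampleLaw (n + 1) {x | vertexCount x = k} = (n + 1) * ∫⁻ V, sampleLaw n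
      {y | (∀ j, Above V (y j)) ∧ vertexNumber (insert V (Set.range y)) = k} ∂uniformTriangle := by
  let M : Set ((ℝ × ℝ) × (Fin n → ℝ × ℝ)) :=
    {q | (∀ j, Above q.1 (q.2 j)) ∧ vertexNumber (insert q.1 (Set.range q.2)) = k}
  have hM : MeasurableSet M := measurableSet_above_vertexNumber n k
  let e := fun i : Fin (n + 1) => MeasurableEquiv.piFinSuccAbove (fun _ => ℝ × ℝ) i
  have he : ∀ i, MeasurePreserving (e i) (sampleLaw (n + 1)) (uniformTriangle.prod (sampleLaw n)) :=
    fun i => measurePreserving_piFinSuccAbove (fun _ => uniformTriangle) i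
  have happ : ∀ i x, e i x = (x i, fun j => x (i.succAbove j)) := fun i x => rfl
  have hrange : ∀ (i : Fin (n + 1)) (x : Fin (n + 1) → ℝ × ℝ),
      insert (x i) (Set.range fun j => x (i.succAbove j)) = Set.range x := by
    intro i x
    ext p
    constructor
    · rintro (rfl | ⟨j, rfl⟩) <;> exact ⟨_, rfl⟩
    · rintro ⟨j, rfl⟩
      rcases Fin.eq_self_or_eq_succAbove i j with rfl | ⟨l, rfl⟩
      · exact Or.inl rfl
      · exact Or.inr ⟨l, rfl⟩
  -- two points are almost surely not on a common line through `(1,0)`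
  have hprod : ∀ᵐ q ∂(uniformTriangle.prod (sampleLaw n)),
      ∀ j, (q.2 j).2 * (1 - q.1.1) ≠ q.1.2 * (1 - (q.2 j).1) := by
    have hms : MeasurableSet {q : (ℝ × ℝ) × (Fin n → ℝ × ℝ) |
        ∀ j, (q.2 j).2 * (1 - q.1.1) ≠ q.1.2 * (1 - (q.2 j).1)} := by
      have : {q : (ℝ × ℝ) × (Fin n → ℝ × ℝ) |
          ∀ j, (q.2 j).2 * (1 - q.1.1) ≠ q.1.2 * (1 - (q.2 j).1)}
          = ⋂ j, {q | (q.2 j).2 * (1 - q.1.1) = q.1.2 * (1 - (q.2 j).1)}ᶜ := by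
        ext; simp
      rw [this]
      exact MeasurableSet.iInter fun j => (measurableSet_eq_fun (by fun_prop) (by fun_prop)).compl
    rw [Measure.ae_prod_iff_ae_ae hms]
    filter_upwards [ae_mem_openTriangle] with V hV
    have hline := ae_notMem_line (a := V.2) (b := 1 - V.1) (c := V.2) (Or.inl hV.2.1.ne')
    filter_upwards [ae_forall_sampleLaw hline] with y hy j h
    exact hy j (by linarith)
  have hae : {x : Fin (n + 1) → ℝ × ℝ | vertexCount x = k} =ᵐ[sampleLaw (n + 1)]
      ⋃ i ∈ (Finset.univ : Finset (Fin (n + 1))), e i ⁻¹' M := by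
    have hne : ∀ᵐ x ∂sampleLaw (n + 1), ∀ i j,
        (x (i.succAbove j)).2 * (1 - (x i).1) ≠ (x i).2 * (1 - (x (i.succAbove j)).1) :=
      Filter.eventually_all.2 fun i => (he i).quasiMeasurePreserving.ae hprod
    filter_upwards [hne, ae_forall_sampleLaw ae_mem_openTriangle] with x hx hT
    refine propext ?_
    change vertexCount x = k ↔ x ∈ ⋃ i ∈ (Finset.univ : Finset (Fin (n + 1))), e i ⁻¹' M
    simp only [Set.mem_iUnion]
    constructor
    · intro hk
      obtain ⟨i, -, hi⟩ := Finset.exists_min_image Finset.univ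
        (fun i => (x i).2 / (1 - (x i).1)) Finset.univ_nonempty
      refine ⟨i, Finset.mem_univ _, fun j => ?_, ?_⟩
      · have h := hi (i.succAbove j) (Finset.mem_univ _)
        have hp : ∀ i, 0 < 1 - (x i).1 := fun i => by
          have h1 := (hT i).2.1
          have h2 := (hT i).2.2
          linarith
        rw [div_le_div_iff₀ (hp _) (hp _)] at h
        exact lt_of_le_of_ne h (hx i j).symm
      · change vertexNumber (insert (x i) (Set.range fun j => x (i.succAbove j))) = k
        rw [hrange]
        exact hk
    · rintro ⟨i, -, -, hk⟩
      change vertexNumber (insert (x i) (Set.range fun j => x (i.succAbove j))) = k at hk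
      rw [hrange] at hk
      exact hk
  have hdisj : (↑(Finset.univ : Finset (Fin (n + 1))) : Set (Fin (n + 1))).PairwiseDisjoint
      fun i => e i ⁻¹' M := by
    intro i _ i' _ hne
    rw [Function.onFun, Set.disjoint_left]
    rintro x ⟨h, -⟩ ⟨h', -⟩
    obtain ⟨j, hj⟩ := Fin.exists_succAbove_eq hne.symm
    obtain ⟨j', hj'⟩ := Fin.exists_succAbove_eq hne
    have a := h j
    have a' := h' j'
    simp only [happ, Above, hj, hj'] at a a'
    exact lt_asymm a a'
  rw [measure_congr hae, measure_biUnion_finset hdisj fun i _ => (e i).measurable hM]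
  have hi : ∀ i, sampleLaw (n + 1) (e i ⁻¹' M) = ∫⁻ V, sampleLaw n
      {y | (∀ j, Above V (y j)) ∧ vertexNumber (insert V (Set.range y)) = k} ∂uniformTriangle := by
    intro i
    rw [(he i).measure_preimage hM.nullMeasurableSet, Measure.prod_apply hM]
    rfl
  simp [hi]

lemma integral_pow_mul_one_sub_pow (m l : ℕ) :
    ∫ x in (0 : ℝ)..1, x ^ m * (1 - x) ^ l
      = m.factorial * l.factorial / (m + l + 1).factorial := by
  induction m generalizing l with
  | zero =>
    have : ∫ x in (0 : ℝ)..1, x ^ 0 * (1 - x) ^ l = ∫ x in (0 : ℝ)..1, (1 - x) ^ l := by simp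
    rw [this, intervalIntegral.integral_comp_sub_left (fun x => x ^ l) 1]
    simp only [sub_self, sub_zero, integral_pow, Nat.factorial_zero, zero_add, Nat.factorial_succ]
    push_cast
    have := (Nat.factorial_pos l)
    field_simp
    simp
  | succ m ih =>
    -- integration by parts
    have hd : ∀ x : ℝ, HasDerivAt (fun x : ℝ => x ^ (m + 1) * (1 - x) ^ (l + 1))
        ((m + 1) * (x ^ m * (1 - x) ^ (l + 1)) - (l + 1) * (x ^ (m + 1) * (1 - x) ^ l)) x := by
      intro x
      have h1 := hasDerivAt_pow (m + 1) x
      have h2 := ((hasDerivAt_id x).const_sub 1).pow (l + 1)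
      convert! h1.mul h2 using 1
      simp
      ring
    have h := intervalIntegral.integral_eq_sub_of_hasDerivAt (a := 0) (b := 1) (fun x _ => hd x)
      (Continuous.intervalIntegrable (by fun_prop) _ _)
    rw [intervalIntegral.integral_sub (Continuous.intervalIntegrable (by fun_prop) _ _)
      (Continuous.intervalIntegrable (by fun_prop) _ _), intervalIntegral.integral_const_mul,
      intervalIntegral.integral_const_mul, ih] at h
    simp only [sub_self, ne_eq, Nat.add_eq_zero_iff, one_ne_zero, and_false, not_false_eq_true,
      zero_pow, mul_zero, zero_mul] at h
    have hl : ((l : ℝ) + 1) ≠ 0 := by positivity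
    apply mul_left_cancel₀ hl
    have e : m + 1 + l + 1 = m + (l + 1) + 1 := by ring
    rw [e]
    simp only [Nat.factorial_succ m, Nat.factorial_succ l] at h ⊢
    push_cast at h ⊢
    linear_combination -h

lemma lintegral_Ioo_ofReal {f : ℝ → ℝ} {a b : ℝ} (hab : a ≤ b) (hf : Continuous f)
    (h0 : ∀ x ∈ Set.Ioo a b, 0 ≤ f x) :
    ∫⁻ x in Set.Ioo a b, ENNReal.ofReal (f x) = ENNReal.ofReal (∫ x in a..b, f x) := by
  rw [intervalIntegral.integral_of_le hab, integral_Ioc_eq_integral_Ioo,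
    ofReal_integral_eq_lintegral_ofReal
      ((hf.integrableOn_Icc (a := a) (b := b)).mono_set Set.Ioo_subset_Icc_self)]
  exact (ae_restrict_iff' measurableSet_Ioo).2 (Filter.Eventually.of_forall h0)

/-- Given `V`, each of `n` points lies in the upper and in the lower triangle of `V` with
probabilities `upperArea V` and `lowerArea V`. Averaging over `V` gives a beta integral. -/
lemma lintegral_upperArea_mul_lowerArea {n m : ℕ} (hm : m ≤ n) :
    ∫⁻ V, ENNReal.ofReal (upperArea V) ^ m * ENNReal.ofReal (lowerArea V) ^ (n - m)
        ∂uniformTriangle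
      = ENNReal.ofReal (2 / (n + 1) *
        (m.factorial * (n + 1 - m).factorial / (n + 2).factorial)) := by
  have hmeas : Measurable fun V : ℝ × ℝ =>
      ENNReal.ofReal (upperArea V) ^ m * ENNReal.ofReal (lowerArea V) ^ (n - m) := by
    unfold upperArea lowerArea; fun_prop
  have hinner : ∀ x ∈ Set.Ioo (0 : ℝ) 1, ∫⁻ y in Set.Ioo 0 (1 - x),
      ENNReal.ofReal (upperArea (x, y)) ^ m * ENNReal.ofReal (lowerArea (x, y)) ^ (n - m)
      = ENNReal.ofReal (1 / (n + 1) * (x ^ m * (1 - x) ^ (n + 1 - m))) := by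
    intro x hx
    have hx1 : 0 < 1 - x := by linarith [hx.2]
    have h1 : ∀ y ∈ Set.Ioo 0 (1 - x),
        ENNReal.ofReal (upperArea (x, y)) ^ m * ENNReal.ofReal (lowerArea (x, y)) ^ (n - m)
        = ENNReal.ofReal ((x / (1 - x)) ^ m * (1 - x - y) ^ n) := by
      intro y hy
      have hV : (x, y) ∈ openTriangle := ⟨hx.1, hy.1, by have := hy.2; simp only; linarith⟩
      rw [← ENNReal.ofReal_pow (upperArea_pos hV).le, ← ENNReal.ofReal_pow (lowerArea_pos hV).le,
        ← ENNReal.ofReal_mul (by have := upperArea_pos hV; positivity)]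
      congr 1
      have e : upperArea (x, y) = x / (1 - x) * (1 - x - y) := by
        simp only [upperArea]; field_simp
      rw [e, lowerArea, mul_pow, mul_assoc, ← pow_add, Nat.add_sub_cancel' hm]
    rw [setLIntegral_congr_fun measurableSet_Ioo h1, lintegral_Ioo_ofReal hx1.le (by fun_prop)]
    · congr 1
      rw [intervalIntegral.integral_const_mul,
        intervalIntegral.integral_comp_sub_left (fun y => y ^ n) (1 - x)]
      simp only [sub_self, sub_zero, integral_pow]
      have : n + 1 = (n + 1 - m) + m := by omega
      rw [zero_pow (by omega), sub_zero, div_pow]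
      conv_lhs => rw [this, pow_add]
      field_simp
    · intro y hy
      have h2 : 0 ≤ 1 - x - y := by linarith [hy.2]
      have h3 := hx.1.le
      positivity
  have hout : ∫⁻ V in openTriangle,
      ENNReal.ofReal (upperArea V) ^ m * ENNReal.ofReal (lowerArea V) ^ (n - m)
      = ENNReal.ofReal (1 / (n + 1) *
        (m.factorial * (n + 1 - m).factorial / (n + 2).factorial)) := by
    rw [← lintegral_indicator measurableSet_openTriangle, Measure.volume_eq_prod,
      lintegral_prod _ (hmeas.indicator measurableSet_openTriangle).aemeasurable]
    have hx : ∀ x : ℝ, ∫⁻ y, openTriangle.indicator (fun V =>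
        ENNReal.ofReal (upperArea V) ^ m * ENNReal.ofReal (lowerArea V) ^ (n - m)) (x, y)
        = (Set.Ioo (0 : ℝ) 1).indicator (fun x => ENNReal.ofReal
          (1 / (n + 1) * (x ^ m * (1 - x) ^ (n + 1 - m)))) x := by
      intro x
      by_cases hx : x ∈ Set.Ioo (0 : ℝ) 1
      · rw [Set.indicator_of_mem hx, ← hinner x hx, ← lintegral_indicator measurableSet_Ioo]
        refine lintegral_congr fun y => ?_
        by_cases hy : y ∈ Set.Ioo 0 (1 - x)
        · rw [Set.indicator_of_mem hy, Set.indicator_of_mem]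
          exact ⟨hx.1, hy.1, by have := hy.2; simp only; linarith⟩
        · rw [Set.indicator_of_notMem hy, Set.indicator_of_notMem]
          rintro ⟨-, h2, h3⟩
          simp only at h2 h3
          exact hy ⟨h2, by linarith⟩
      · rw [Set.indicator_of_notMem hx]
        have : ∀ y, openTriangle.indicator (fun V : ℝ × ℝ =>
            ENNReal.ofReal (upperArea V) ^ m * ENNReal.ofReal (lowerArea V) ^ (n - m)) (x, y)
            = 0 := by
          intro y
          apply Set.indicator_of_notMem
          rintro ⟨h1, h2, h3⟩
          simp only at h1 h2 h3
          exact hx ⟨h1, by linarith⟩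
        simp [this]
    simp_rw [hx]
    rw [lintegral_indicator measurableSet_Ioo, lintegral_Ioo_ofReal zero_le_one (by fun_prop),
      intervalIntegral.integral_const_mul, integral_pow_mul_one_sub_pow]
    · rw [show m + (n + 1 - m) + 1 = n + 2 by omega]
    · intro x hx
      have h1 := hx.1.le
      have h2 : 0 ≤ 1 - x := by linarith [hx.2]
      positivity
  rw [uniformTriangle_eq, lintegral_smul_measure, hout, smul_eq_mul,
    show (2 : ENNReal) = ENNReal.ofReal 2 by simp, ← ENNReal.ofReal_mul (by norm_num)]
  congr 1
  ring

lemma sampleLaw_succ (n k : ℕ) :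
    sampleLaw (n + 1) {x | vertexCount x = k}
      = ∑ m ∈ Finset.range (n + 1),
        ENNReal.ofReal (2 * (n + 1 - m : ℕ) / ((n + 1) * (n + 2))) * shiftedLaw m k := by
  have hmeas : ∀ m : ℕ, Measurable fun V : ℝ × ℝ =>
      ENNReal.ofReal (upperArea V) ^ m * ENNReal.ofReal (lowerArea V) ^ (n - m) := by
    intro m; unfold upperArea lowerArea; fun_prop
  rw [sampleLaw_succ_eq_lintegral]
  have h1 : ∫⁻ V, sampleLaw n
      {y | (∀ j, Above V (y j)) ∧ vertexNumber (insert V (Set.range y)) = k} ∂uniformTriangle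
      = ∫⁻ V, ∑ m ∈ Finset.range (n + 1), (n.choose m * shiftedLaw m k) *
        (ENNReal.ofReal (upperArea V) ^ m * ENNReal.ofReal (lowerArea V) ^ (n - m))
          ∂uniformTriangle := by
    refine lintegral_congr_ae ?_
    filter_upwards [ae_mem_openTriangle] with V hV
    rw [sampleLaw_above hV, ← Finset.powerset_univ, Finset.sum_powerset_apply_card fun m =>
      ENNReal.ofReal (upperArea V) ^ m * shiftedLaw m k * ENNReal.ofReal (lowerArea V) ^ (n - m)]
    simp only [Finset.card_univ, Fintype.card_fin, nsmul_eq_mul]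
    exact Finset.sum_congr rfl fun m _ => by ring
  rw [h1, lintegral_finsetSum _ fun m _ => (hmeas m).const_mul _, Finset.mul_sum]
  refine Finset.sum_congr rfl fun m hm => ?_
  have hm' : m ≤ n := Nat.lt_succ_iff.1 (Finset.mem_range.1 hm)
  rw [lintegral_const_mul _ (hmeas m), lintegral_upperArea_mul_lowerArea hm']
  have e : ((n : ENNReal) + 1) = ENNReal.ofReal (n + 1) := by
    rw [ENNReal.ofReal_add (by positivity) zero_le_one]; simp
  have e2 : (n.choose m : ENNReal) = ENNReal.ofReal (n.choose m) := by simp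
  rw [e, e2, mul_comm (ENNReal.ofReal (n.choose m)), mul_assoc, mul_left_comm,
    ← ENNReal.ofReal_mul (by positivity), ← ENNReal.ofReal_mul (by positivity), mul_comm]
  congr 2
  rw [Nat.cast_choose ℝ hm']
  have e3 : n + 1 - m = (n - m) + 1 := by omega
  rw [e3, Nat.factorial_succ (n - m), Nat.factorial_succ (n + 1), Nat.factorial_succ n]
  have := Nat.factorial_pos (n - m)
  have := Nat.factorial_pos m
  have := Nat.factorial_pos n
  push_cast
  field_simp
  ring

lemma vertexProb_eq_toReal (n k : ℕ) :
    vertexProb n k = (sampleLaw n {x | vertexCount x = k}).toReal := rfl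

/-- The vertex probabilities in terms of those of smaller samples: `m` is the number of points
which are separated from `(1,0)` by the line through the last vertex and `(0,1)`. -/
lemma vertexProb_succ_succ (n k : ℕ) :
    vertexProb (n + 1) (k + 1) = ∑ m ∈ Finset.range (n + 1),
      2 * ((n : ℝ) + 1 - m) / ((n + 1) * (n + 2)) * vertexProb m k := by
  rw [vertexProb_eq_toReal, sampleLaw_succ, ENNReal.toReal_sum]
  · refine Finset.sum_congr rfl fun m hm => ?_
    have hm' : m ≤ n + 1 := (Finset.mem_range.1 hm).le
    rw [ENNReal.toReal_mul, ENNReal.toReal_ofReal (by positivity), Nat.cast_sub hm',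
      vertexProb_eq_toReal, shiftedLaw]
    simp
  · intro m _
    exact ENNReal.mul_ne_top ENNReal.ofReal_ne_top (measure_ne_top _ _)

lemma vertexProb_succ_zero (n : ℕ) : vertexProb (n + 1) 0 = 0 := by
  rw [vertexProb_eq_toReal, sampleLaw_succ]
  simp [shiftedLaw]

lemma vertexCount_le {n : ℕ} (x : Fin n → ℝ × ℝ) : vertexCount x ≤ n := by
  have : (chain x).extremePoints ℝ \ corners ⊆ Set.range x := by
    rintro p ⟨hp, hc⟩
    exact (extremePoints_convexHull_subset hp).resolve_right hc
  calc vertexCount x ≤ (Set.range x).ncard := Set.ncard_le_ncard this (Set.finite_range x)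
    _ ≤ n := by
      rw [← Set.image_univ]
      exact (Set.ncard_image_le Set.finite_univ).trans (by simp [Set.ncard_univ])

lemma vertexProb_eq_zero {n k : ℕ} (h : n < k) : vertexProb n k = 0 := by
  rw [vertexProb_eq_toReal]
  have : {x : Fin n → ℝ × ℝ | vertexCount x = k} = ∅ := by
    ext x
    have := vertexCount_le x
    simp only [Set.mem_ofPred_eq, Set.mem_empty_iff_false, iff_false]
    omega
  simp [this]

lemma vertexProb_zero_zero : vertexProb 0 0 = 1 := by
  rw [vertexProb_eq_toReal]
  have : {x : Fin 0 → ℝ × ℝ | vertexCount x = 0} = Set.univ := by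
    ext x
    simpa using vertexCount_le x
  simp [this]

/-! ### The generating polynomials -/

lemma G_eq_sum {n N : ℕ} (h : n ≤ N) :
    G n = ∑ k ∈ Finset.range (N + 1), C (vertexProb n k) * X ^ k := by
  have hN : ∑ k ∈ Finset.range (N + 1), C (vertexProb n k) * X ^ k
      = ∑ k ∈ Finset.range (n + 1), C (vertexProb n k) * X ^ k := by
    symm
    refine Finset.sum_subset (Finset.range_subset_range.2 (by omega)) fun k _ hk => ?_
    rw [vertexProb_eq_zero (by simpa using hk)]
    simp
  rw [hN]
  rcases n with _ | n
  · simp [G, vertexProb_zero_zero]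
  · rw [G, if_neg (by omega), Finset.sum_range_succ', vertexProb_succ_zero, map_zero, zero_mul,
      add_zero, Finset.range_eq_Ico, Finset.sum_Ico_add' (fun k => C (vertexProb (n + 1) k) * X ^ k)]
    rfl

lemma G_zero : G 0 = 1 := by simp [G]

lemma eval_G_succ (n : ℕ) (z : ℝ) :
    (n + 1) * (n + 2) * (G (n + 1)).eval z
      = 2 * z * ∑ m ∈ Finset.range (n + 1), ((n : ℝ) + 1 - m) * (G m).eval z := by
  have h1 : ∀ m ∈ Finset.range (n + 1),
      (G m).eval z = ∑ k ∈ Finset.range (n + 1), vertexProb m k * z ^ k := by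
    intro m hm
    rw [G_eq_sum (Nat.lt_succ_iff.1 (Finset.mem_range.1 hm)), eval_finsetSum]
    simp
  rw [G_eq_sum le_rfl, eval_finsetSum, Finset.sum_range_succ', vertexProb_succ_zero]
  simp only [eval_mul, eval_C, eval_pow, eval_X, zero_mul, add_zero]
  have h2 : ∑ m ∈ Finset.range (n + 1), ((n : ℝ) + 1 - m) * (G m).eval z
      = ∑ m ∈ Finset.range (n + 1), ((n : ℝ) + 1 - m) *
        ∑ k ∈ Finset.range (n + 1), vertexProb m k * z ^ k :=
    Finset.sum_congr rfl fun m hm => by rw [h1 m hm]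
  rw [h2]
  simp only [vertexProb_succ_succ, Finset.mul_sum, Finset.sum_mul]
  rw [Finset.sum_comm]
  refine Finset.sum_congr rfl fun m _ => Finset.sum_congr rfl fun k _ => ?_
  field_simp
  ring

lemma eval_G_one (z : ℝ) : (G 1).eval z = z := by
  have := eval_G_succ 0 z
  simp [G_zero] at this
  linarith

lemma eval_G_recurrence (n : ℕ) (z : ℝ) :
    (n + 2) * (n + 3) * (G (n + 2)).eval z
      = (2 * (n + 1) * (n + 2) + 2 * z) * (G (n + 1)).eval z - n * (n + 1) * (G n).eval z := by
  have h2 := eval_G_succ (n + 1) z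
  have h1 := eval_G_succ n z
  rw [Finset.sum_range_succ] at h2
  rcases n with _ | n
  · simp [G_zero] at h1 h2 ⊢
    linear_combination h2 - 4 * h1
  have h0 := eval_G_succ n z
  rw [Finset.sum_range_succ] at h1 h2
  have e : ∀ c : ℝ, ∑ m ∈ Finset.range (n + 1), (c - m) * (G m).eval z
      = ∑ m ∈ Finset.range (n + 1), ((n : ℝ) + 1 - m) * (G m).eval z
        + (c - n - 1) * ∑ m ∈ Finset.range (n + 1), (G m).eval z := by
    intro c
    rw [Finset.mul_sum, ← Finset.sum_add_distrib]
    exact Finset.sum_congr rfl fun m _ => by ring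
  push_cast at h0 h1 h2 ⊢
  rw [e] at h1 h2
  linear_combination h2 - 2 * h1 + h0

lemma vertexProb_self (n : ℕ) :
    vertexProb n n = 2 ^ n / ((n.factorial : ℝ) * ((n + 1).factorial : ℝ)) := by
  induction n with
  | zero => simp [vertexProb_zero_zero]
  | succ n ih =>
    rw [vertexProb_succ_succ, Finset.sum_range_succ, Finset.sum_eq_zero, ih]
    · rw [Nat.factorial_succ (n + 1), Nat.factorial_succ n]
      have := Nat.factorial_pos n
      push_cast
      field_simp
      ring
    · intro m hm
      rw [vertexProb_eq_zero (Finset.mem_range.1 hm), mul_zero]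

lemma vertexProb_self_pos (n : ℕ) : 0 < vertexProb n n := by
  rw [vertexProb_self]
  positivity

lemma natDegree_G_le (n : ℕ) : (G n).natDegree ≤ n := by
  rw [G_eq_sum le_rfl]
  refine natDegree_sum_le_of_forall_le _ _ fun k hk => ?_
  exact (natDegree_C_mul_X_pow_le _ _).trans (Nat.lt_succ_iff.1 (Finset.mem_range.1 hk))

lemma coeff_G_self (n : ℕ) : (G n).coeff n = vertexProb n n := by
  rw [G_eq_sum le_rfl, finsetSum_coeff]
  simp [coeff_X_pow]

lemma monic_H (n : ℕ) : (H n).Monic := by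
  refine monic_of_natDegree_le_of_coeff_eq_one n ?_ ?_
  · exact (natDegree_C_mul_le _ _).trans (natDegree_G_le n)
  · rw [H, coeff_C_mul, coeff_G_self, inv_mul_cancel₀ (vertexProb_self_pos n).ne']

lemma natDegree_H (n : ℕ) : (H n).natDegree = n := by
  refine le_antisymm ((natDegree_C_mul_le _ _).trans (natDegree_G_le n)) ?_
  refine le_natDegree_of_ne_zero ?_
  rw [H, coeff_C_mul, coeff_G_self, inv_mul_cancel₀ (vertexProb_self_pos n).ne']
  exact one_ne_zero

lemma eval_G_eq (n : ℕ) (z : ℝ) : (G n).eval z = vertexProb n n * (H n).eval z := by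
  rw [H, eval_mul, eval_C, mul_inv_cancel_left₀ (vertexProb_self_pos n).ne']

lemma H_zero : H 0 = 1 := by
  rw [H, G_zero, vertexProb_zero_zero]; simp

lemma H_one : H 1 = X := by
  refine funext fun z => ?_
  have := eval_G_eq 1 z
  rw [eval_G_one, vertexProb_self] at this
  simp at this
  rw [eval_X]
  exact this.symm

lemma eval_H_recurrence (n : ℕ) (z : ℝ) :
    (H (n + 2)).eval z = (z + (n + 2) * (n + 1)) * (H (n + 1)).eval z
      - (n + 2) * (n + 1) ^ 2 * n / 4 * (H n).eval z := by
  have h := eval_G_recurrence n z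
  rw [eval_G_eq, eval_G_eq, eval_G_eq, vertexProb_self, vertexProb_self, vertexProb_self,
    Nat.factorial_succ (n + 2), Nat.factorial_succ (n + 1), Nat.factorial_succ n] at h
  have h0 : (0 : ℝ) < n.factorial := by exact_mod_cast Nat.factorial_pos n
  push_cast at h
  field_simp at h
  apply mul_left_cancel₀ (by positivity : (2 : ℝ) ^ n * (4 * (n + 2) * (n + 3)) ≠ 0)
  ring_nf at h ⊢
  linear_combination h

lemma H_recurrence (n : ℕ) :
    H (n + 2) = (X + C ((n + 2) * (n + 1) : ℝ)) * H (n + 1)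
      - C ((n + 2) * (n + 1) ^ 2 * n / 4 : ℝ) * H n := by
  refine funext fun z => ?_
  rw [eval_H_recurrence]
  simp

lemma coeff_zero_H_succ (n : ℕ) : (H (n + 1)).coeff 0 = 0 := by
  have := eval_G_succ n 0
  rw [eval_G_eq, mul_zero, zero_mul] at this
  have h := (vertexProb_self_pos (n + 1)).ne'
  rw [coeff_zero_eq_eval_zero]
  have hn : ((n : ℝ) + 1) * (n + 2) ≠ 0 := by positivity
  simpa [hn, h] using this

/-! ### Expansion in shifted products -/

/-- The products `∏ j < k, (j (j + 1) - 2 z)`, which equal the products of Pochhammer symbols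
`(1/2 + i t)_k (1/2 - i t)_k` for `z = -(t ^ 2 + 1 / 4) / 2`. -/
noncomputable def shiftedProd (k : ℕ) : ℝ[X] :=
  ∏ j ∈ Finset.range k, (C ((j : ℝ) * (j + 1)) - C 2 * X)

lemma eval_shiftedProd_succ (k : ℕ) (z : ℝ) :
    (shiftedProd (k + 1)).eval z = (shiftedProd k).eval z * (k * (k + 1) - 2 * z) := by
  simp [shiftedProd, Finset.prod_range_succ]

/-- The coefficients of `G (n + 1)` with respect to the products `shiftedProd (k + 1)`. -/
noncomputable def expansionCoeff (n k : ℕ) : ℝ :=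
  (-1) ^ (k + 1) * n.choose k / ((k + 1).factorial * (k + 2).factorial)

lemma expansionCoeff_recurrence_zero (n : ℕ) :
    ((n : ℝ) + 3) * (n + 4) * expansionCoeff (n + 2) 0
      = (2 * (n + 2) * (n + 3) + 2) * expansionCoeff (n + 1) 0
        - (n + 1) * (n + 2) * expansionCoeff n 0 := by
  simp [expansionCoeff]
  ring

lemma expansionCoeff_recurrence_succ (n k : ℕ) :
    ((n : ℝ) + 3) * (n + 4) * expansionCoeff (n + 2) (k + 1)
      = (2 * (n + 2) * (n + 3) + (k + 2) * (k + 3)) * expansionCoeff (n + 1) (k + 1)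
        - expansionCoeff (n + 1) k - (n + 1) * (n + 2) * expansionCoeff n (k + 1) := by
  have h1 : ((n : ℝ) + 1) * n.choose (k + 1) = (n - k) * (n + 1).choose (k + 1) := by
    rcases le_or_gt k n with h | h
    · have := Nat.choose_mul_succ_eq n (k + 1)
      rw [Nat.succ_sub_succ] at this
      have := congrArg (Nat.cast (R := ℝ)) this
      rw [Nat.cast_mul, Nat.cast_mul, Nat.cast_sub h] at this
      push_cast at this
      linarith
    · rw [Nat.choose_eq_zero_of_lt (by omega : n < k + 1),
        Nat.choose_eq_zero_of_lt (by omega : n + 1 < k + 1)]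
      simp
  have h2 : ((n : ℝ) + 2) * (n + 1).choose (k + 1) = (n + 1 - k) * (n + 2).choose (k + 1) := by
    rcases le_or_gt k (n + 1) with h | h
    · have := Nat.choose_mul_succ_eq (n + 1) (k + 1)
      rw [Nat.succ_sub_succ] at this
      have := congrArg (Nat.cast (R := ℝ)) this
      rw [Nat.cast_mul, Nat.cast_mul, Nat.cast_sub h] at this
      push_cast at this
      linarith
    · rw [Nat.choose_eq_zero_of_lt (by omega : n + 1 < k + 1),
        Nat.choose_eq_zero_of_lt (by omega : n + 2 < k + 1)]
      simp
  have h3 : ((n + 2).choose (k + 1) : ℝ) = (n + 1).choose k + (n + 1).choose (k + 1) := by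
    rw [Nat.choose_succ_succ]; push_cast; rfl
  have h0 : (0 : ℝ) < k.factorial := by exact_mod_cast Nat.factorial_pos k
  simp only [expansionCoeff, Nat.factorial_succ (k + 2), Nat.factorial_succ (k + 1),
    Nat.factorial_succ k, pow_succ (-1 : ℝ) (k + 1)]
  push_cast
  field_simp
  have h4 : ((n + 1).choose k : ℝ) = (n + 2).choose (k + 1) - (n + 1).choose (k + 1) := by
    linarith
  rw [h4]
  linear_combination (-(n + 2 : ℝ)) * h1 + (n + 6 + k : ℝ) * h2

lemma expansionCoeff_eq_zero {n k : ℕ} (h : n < k) : expansionCoeff n k = 0 := by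
  simp [expansionCoeff, Nat.choose_eq_zero_of_lt h]

lemma G_succ_eq_sum {n N : ℕ} (h : n ≤ N) :
    G (n + 1) = ∑ k ∈ Finset.range (N + 1), C (expansionCoeff n k) * shiftedProd (k + 1) := by
  refine funext fun z => ?_
  simp only [eval_finsetSum, eval_mul, eval_C]
  have h1 : (shiftedProd 1).eval z = -(2 * z) := by simp [shiftedProd]
  have h2 : (shiftedProd 2).eval z = -(2 * z) * (2 - 2 * z) := by
    rw [eval_shiftedProd_succ 1, h1]; norm_num
  have hext : ∀ {m M : ℕ}, m ≤ M → ∑ k ∈ Finset.range (M + 1),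
      expansionCoeff m k * (shiftedProd (k + 1)).eval z
      = ∑ k ∈ Finset.range (m + 1), expansionCoeff m k * (shiftedProd (k + 1)).eval z := by
    intro m M hM
    symm
    refine Finset.sum_subset (Finset.range_subset_range.2 (by omega)) fun k _ hk => ?_
    rw [expansionCoeff_eq_zero (by simpa using hk), zero_mul]
  rw [hext h]
  clear h N
  induction n using Nat.strong_induction_on with
  | _ n ih =>
  rcases n with _ | _ | n
  · simp [eval_G_one, expansionCoeff, h1]
    ring
  · have := eval_G_recurrence 0 z
    rw [eval_G_one] at this
    simp only [zero_add] at this ⊢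
    rw [Finset.sum_range_succ, Finset.sum_range_one, h1, h2]
    simp [expansionCoeff, Nat.factorial] at this ⊢
    linarith
  have i1 := ih (n + 1) (by omega)
  have i0 := ih n (by omega)
  rw [← hext (by omega : n + 1 ≤ n + 2)] at i1
  rw [← hext (by omega : n ≤ n + 2)] at i0
  have hr := eval_G_recurrence (n + 1) z
  have hs : ((n : ℝ) + 3) * (n + 4) * ∑ k ∈ Finset.range (n + 2),
        expansionCoeff (n + 2) (k + 1) * (shiftedProd (k + 2)).eval z
      = 2 * (n + 2) * (n + 3) * ∑ k ∈ Finset.range (n + 2),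
          expansionCoeff (n + 1) (k + 1) * (shiftedProd (k + 2)).eval z
        + ∑ k ∈ Finset.range (n + 2), ((k : ℝ) + 2) * (k + 3) *
          (expansionCoeff (n + 1) (k + 1) * (shiftedProd (k + 2)).eval z)
        - ∑ k ∈ Finset.range (n + 2), expansionCoeff (n + 1) k * (shiftedProd (k + 2)).eval z
        - (n + 1) * (n + 2) * ∑ k ∈ Finset.range (n + 2),
          expansionCoeff n (k + 1) * (shiftedProd (k + 2)).eval z := by
    simp only [Finset.mul_sum, ← Finset.sum_add_distrib, ← Finset.sum_sub_distrib]
    refine Finset.sum_congr rfl fun k _ => ?_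
    linear_combination (shiftedProd (k + 2)).eval z * expansionCoeff_recurrence_succ n k
  have hz : 2 * z * ∑ k ∈ Finset.range (n + 2 + 1),
        expansionCoeff (n + 1) k * (shiftedProd (k + 1)).eval z
      = ∑ k ∈ Finset.range (n + 2), ((k : ℝ) + 2) * (k + 3) *
          (expansionCoeff (n + 1) (k + 1) * (shiftedProd (k + 2)).eval z)
        + 2 * (expansionCoeff (n + 1) 0 * (shiftedProd 1).eval z)
        - ∑ k ∈ Finset.range (n + 2), expansionCoeff (n + 1) k * (shiftedProd (k + 2)).eval z := by
    have e1 : 2 * z * ∑ k ∈ Finset.range (n + 2 + 1),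
        expansionCoeff (n + 1) k * (shiftedProd (k + 1)).eval z
        = ∑ k ∈ Finset.range (n + 2 + 1), ((k : ℝ) + 1) * (k + 2) *
          (expansionCoeff (n + 1) k * (shiftedProd (k + 1)).eval z)
        - ∑ k ∈ Finset.range (n + 2 + 1),
          expansionCoeff (n + 1) k * (shiftedProd (k + 2)).eval z := by
      simp only [Finset.mul_sum, ← Finset.sum_sub_distrib]
      refine Finset.sum_congr rfl fun k _ => ?_
      rw [eval_shiftedProd_succ (k + 1)]
      push_cast
      ring
    rw [e1, Finset.sum_range_succ', Finset.sum_range_succ _ (n + 2),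
      expansionCoeff_eq_zero (by omega : n + 1 < n + 2)]
    push_cast
    simp only [zero_mul, add_zero, add_assoc, zero_add, one_mul, one_add_one_eq_two,
      (by norm_num : (1 : ℝ) + 2 = 3)]
  rw [Finset.sum_range_succ'] at i1 i0 hz ⊢
  have hne : ((n : ℝ) + 3) * (n + 4) ≠ 0 := by positivity
  apply mul_left_cancel₀ hne
  have h0 := expansionCoeff_recurrence_zero n
  push_cast at hr
  rw [i0, i1] at hr
  simp only [add_assoc, one_add_one_eq_two, zero_add, (by norm_num : (1 : ℕ) + 2 = 3),
    (by norm_num : (1 : ℝ) + 2 = 3), (by norm_num : (1 : ℝ) + 3 = 4)] at hr hz hs h0 i0 i1 ⊢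
  linear_combination hr + hz - hs - (shiftedProd 1).eval z * h0

/-! ### A contour integral -/

/-- The quotient `sinh (π z) / z`, continued to the origin. -/
noncomputable def sinhQuot : ℂ → ℂ := dslope (fun z => Complex.sinh (Real.pi * z)) 0

lemma sinhQuot_mul (z : ℂ) : z * sinhQuot z = Complex.sinh (Real.pi * z) := by
  have := sub_smul_dslope (fun z : ℂ => Complex.sinh (Real.pi * z)) 0 z
  simpa [sinhQuot] using this

lemma differentiable_sinhQuot : Differentiable ℂ sinhQuot := by
  rw [← differentiableOn_univ, sinhQuot, Complex.differentiableOn_dslope Filter.univ_mem]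
  exact (by fun_prop : Differentiable ℂ fun z : ℂ => Complex.sinh (Real.pi * z)).differentiableOn

lemma sinhQuot_ne_zero {z : ℂ} (hz : |z.im| ≤ 1 / 2) : sinhQuot z ≠ 0 := by
  intro h
  by_cases h0 : z = 0
  · subst h0
    have hd : HasDerivAt (fun z : ℂ => Complex.sinh (Real.pi * z)) Real.pi 0 := by
      have := ((hasDerivAt_id (0 : ℂ)).const_mul (Real.pi : ℂ)).csinh
      simpa using this
    rw [sinhQuot, dslope_same, hd.deriv] at h
    exact Real.pi_ne_zero (by exact_mod_cast h)
  · have h1 : Complex.sinh (Real.pi * z) = 0 := by rw [← sinhQuot_mul, h, mul_zero]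
    have h2 : Complex.sin (Real.pi * z * Complex.I) = 0 := by
      rw [Complex.sin_mul_I, h1, zero_mul]
    obtain ⟨k, hk⟩ := Complex.sin_eq_zero_iff.1 h2
    have hpi : (Real.pi : ℂ) ≠ 0 := by exact_mod_cast Real.pi_ne_zero
    have h3 : z * Complex.I = k := by
      apply mul_left_cancel₀ hpi
      rw [← mul_assoc, hk, mul_comm]
    have him : z.im = -k := by
      have := congrArg Complex.re h3
      simp at this
      linarith
    have hk0 : k = 0 := by
      rw [him, abs_neg] at hz
      have : |(k : ℝ)| < 1 := by linarith
      have : |k| < 1 := by exact_mod_cast this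
      exact Int.abs_lt_one_iff.1 this
    rw [hk0] at h3
    simp [h0] at h3

/-- The product `∏ 1 ≤ j ≤ k, (j ^ 2 + z ^ 2)`. -/
def squareProd (k : ℕ) (z : ℂ) : ℂ := ∏ j ∈ Finset.range k, (((j : ℂ) + 1) ^ 2 + z ^ 2)

/-- The product `∏ j < k, ((j + 1 / 2) ^ 2 + t ^ 2)`, which is `(1/2 + i t)_k (1/2 - i t)_k`. -/
noncomputable def halfProd (k : ℕ) (t : ℝ) : ℝ :=
  ∏ j ∈ Finset.range k, (((j : ℝ) + 1 / 2) ^ 2 + t ^ 2)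

lemma halfProd_succ (k : ℕ) (t : ℝ) :
    halfProd (k + 1) t = halfProd k t * (((k : ℝ) + 1 / 2) ^ 2 + t ^ 2) :=
  Finset.prod_range_succ _ _

/-- The integrand `z ^ 3 * squareProd k z * cosh (π z) / sinh (π z) ^ 2`, continued to the
origin. -/
noncomputable def contourFun (k : ℕ) (z : ℂ) : ℂ :=
  z * squareProd k z * Complex.cosh (Real.pi * z) / sinhQuot z ^ 2

lemma contourFun_eq {k : ℕ} {z : ℂ} (hz : z ≠ 0) :
    contourFun k z = z ^ 3 * squareProd k z * Complex.cosh (Real.pi * z)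
      / Complex.sinh (Real.pi * z) ^ 2 := by
  rw [contourFun, ← sinhQuot_mul, mul_pow]
  by_cases h : sinhQuot z = 0
  · simp [h]
  · field_simp

/-- Shifting by `± i / 2` telescopes the products, up to the first and the last factor. -/
lemma squareProd_add (k : ℕ) (t : ℝ) :
    (t + Complex.I / 2) ^ 2 * squareProd k (t + Complex.I / 2)
      = halfProd k t * ((Complex.I * t - 1 / 2) * (k + 1 / 2 - Complex.I * t)) := by
  have hI := Complex.I_sq
  induction k with
  | zero => simp [squareProd, halfProd]; linear_combination (t ^ 2 + 1 / 4 : ℂ) * hI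
  | succ k ih =>
    have f1 : ((k : ℂ) + 1) ^ 2 + (t + Complex.I / 2) ^ 2
        = (k + 1 / 2 + Complex.I * t) * (k + 3 / 2 - Complex.I * t) := by
      linear_combination (1 / 4 + t ^ 2 : ℂ) * hI
    have f2 : ((k : ℂ) + 1 / 2) ^ 2 + t ^ 2
        = (k + 1 / 2 + Complex.I * t) * (k + 1 / 2 - Complex.I * t) := by
      linear_combination (t ^ 2 : ℂ) * hI
    rw [squareProd, Finset.prod_range_succ, ← squareProd, ← mul_assoc, ih, halfProd_succ]
    push_cast
    rw [f1, f2]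
    ring

lemma squareProd_sub (k : ℕ) (t : ℝ) :
    (t - Complex.I / 2) ^ 2 * squareProd k (t - Complex.I / 2)
      = halfProd k t * ((-(Complex.I * t) - 1 / 2) * (k + 1 / 2 + Complex.I * t)) := by
  have h := squareProd_add k (-t)
  have e1 : squareProd k (((-t : ℝ) : ℂ) + Complex.I / 2) = squareProd k (t - Complex.I / 2) := by
    unfold squareProd
    refine Finset.prod_congr rfl fun j _ => ?_
    push_cast
    ring
  have e2 : halfProd k (-t) = halfProd k t := by simp [halfProd]
  rw [e1, e2] at h
  push_cast at h
  linear_combination h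

/-- The weight of the orthogonality measure in the variable `t`, where `z = -(t ^ 2 + 1 / 4) / 2`;
it is even, and positive for `t ≠ 0`. -/
noncomputable def weight (t : ℝ) : ℝ := t * Real.sinh (Real.pi * t) / Real.cosh (Real.pi * t) ^ 2

/-- Under the shift by `± i / 2` the functions `cosh` and `sinh` change roles, so the two horizontal
sides of the rectangle combine to an integral against `weight`. -/
lemma contourFun_sub_contourFun (k : ℕ) (t : ℝ) :
    contourFun k (t - Complex.I / 2) - contourFun k (t + Complex.I / 2)
      = 2 * Complex.I * ((t ^ 2 - (k + 3 / 4)) * halfProd k t * weight t : ℝ) := by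
  have hne1 : (t + Complex.I / 2 : ℂ) ≠ 0 := fun h => by
    have := congrArg Complex.im h; simp at this
  have hne2 : (t - Complex.I / 2 : ℂ) ≠ 0 := fun h => by
    have := congrArg Complex.im h; simp at this
  have e1 : (Real.pi : ℂ) * (t + Complex.I / 2) = Real.pi * t + (Real.pi / 2 : ℝ) * Complex.I := by
    push_cast; ring
  have e2 : (Real.pi : ℂ) * (t - Complex.I / 2) = Real.pi * t - (Real.pi / 2 : ℝ) * Complex.I := by
    push_cast; ring
  have hI := Complex.I_sq
  have hc : Complex.cosh (Real.pi * t) ≠ 0 := by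
    rw [← Complex.ofReal_mul, ← Complex.ofReal_cosh]
    exact_mod_cast (Real.cosh_pos _).ne'
  have hcos : Complex.cos ((Real.pi / 2 : ℝ) : ℂ) = 0 := by
    rw [← Complex.ofReal_cos]; simp
  have hsin : Complex.sin ((Real.pi / 2 : ℝ) : ℂ) = 1 := by
    rw [← Complex.ofReal_sin]; simp
  rw [contourFun_eq hne1, contourFun_eq hne2, e1, e2, Complex.cosh_add, Complex.sinh_add,
    Complex.cosh_sub, Complex.sinh_sub, Complex.cosh_mul_I, Complex.sinh_mul_I, hcos, hsin]
  have p1 : (t + Complex.I / 2) ^ 3 * squareProd k (t + Complex.I / 2)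
      = (t + Complex.I / 2) *
        (halfProd k t * ((Complex.I * t - 1 / 2) * (k + 1 / 2 - Complex.I * t))) := by
    rw [← squareProd_add]; ring
  have p2 : (t - Complex.I / 2) ^ 3 * squareProd k (t - Complex.I / 2)
      = (t - Complex.I / 2) *
        (halfProd k t * ((-(Complex.I * t) - 1 / 2) * (k + 1 / 2 + Complex.I * t))) := by
    rw [← squareProd_sub]; ring
  rw [p1, p2, weight]
  push_cast
  simp only [mul_zero, zero_add, one_mul, zero_sub, mul_pow, neg_sq, hI]
  generalize Complex.cosh (Real.pi * t) = c at *
  generalize Complex.sinh (Real.pi * t) = s at *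
  field_simp
  linear_combination (halfProd k t : ℂ) * s * 4 *
    (2 * (2 * k + 1) * (2 * t) + 4 * t - 16 * t ^ 3 : ℂ) * hI

/-! ### Decay of the weight and of the contour integrand -/

lemma weight_nonneg (t : ℝ) : 0 ≤ weight t := by
  refine div_nonneg ?_ (by positivity)
  rcases le_total 0 t with h | h
  · exact mul_nonneg h (Real.sinh_nonneg_iff.2 (by positivity))
  · exact mul_nonneg_of_nonpos_of_nonpos h
      (Real.sinh_nonpos_iff.2 (mul_nonpos_of_nonneg_of_nonpos Real.pi_pos.le h))

lemma weight_pos {t : ℝ} (h : 0 < t) : 0 < weight t :=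
  div_pos (mul_pos h (Real.sinh_pos_iff.2 (by positivity))) (pow_pos (Real.cosh_pos _) 2)

lemma continuous_weight : Continuous weight := by
  unfold weight
  exact Continuous.div (by fun_prop) (by fun_prop) fun t => (pow_pos (Real.cosh_pos _) 2).ne'

lemma weight_le (t : ℝ) : weight t ≤ 2 * (|t| * Real.exp (-(2 * |t|))) := by
  have hc := Real.cosh_pos (Real.pi * t)
  have h1 : weight t ≤ |t| / Real.cosh (Real.pi * t) := by
    rw [weight, div_le_div_iff₀ (by positivity) hc]
    have h2 : t * Real.sinh (Real.pi * t) ≤ |t| * Real.cosh (Real.pi * t) := by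
      refine (le_abs_self _).trans ?_
      rw [abs_mul]
      refine mul_le_mul_of_nonneg_left ?_ (abs_nonneg t)
      rw [Real.abs_sinh, ← Real.cosh_abs]
      exact (Real.sinh_lt_cosh _).le
    nlinarith
  have h3 : Real.exp (2 * |t|) / 2 ≤ Real.cosh (Real.pi * t) := by
    rw [← Real.cosh_abs, Real.cosh_eq, abs_mul, abs_of_pos Real.pi_pos]
    have h4 : Real.exp (2 * |t|) ≤ Real.exp (Real.pi * |t|) :=
      Real.exp_le_exp.2 (mul_le_mul_of_nonneg_right Real.two_le_pi (abs_nonneg t))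
    have := Real.exp_pos (-(Real.pi * |t|))
    linarith
  refine h1.trans ?_
  rw [Real.exp_neg, div_le_iff₀ hc]
  have hE := Real.exp_pos (2 * |t|)
  calc |t| = 2 * (|t| * (Real.exp (2 * |t|))⁻¹) * (Real.exp (2 * |t|) / 2) := by field_simp
    _ ≤ _ := mul_le_mul_of_nonneg_left h3 (by positivity)

lemma integrable_pow_mul_weight (n : ℕ) : Integrable fun t : ℝ => t ^ n * weight t := by
  have hb : ∀ m : ℕ, ∀ t : ℝ, |t| ^ m ≤ m.factorial * Real.exp |t| := by
    intro m t
    have := Real.pow_div_factorial_le_exp |t| (abs_nonneg t) m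
    rwa [div_le_iff₀ (by positivity), mul_comm] at this
  refine (integrable_inv_one_add_sq.const_mul
    (2 * ((n + 1).factorial + (n + 3).factorial : ℝ))).mono'
    (by have := continuous_weight; fun_prop) (Filter.Eventually.of_forall fun t => ?_)
  rw [Real.norm_eq_abs, abs_mul, abs_pow, abs_of_nonneg (weight_nonneg t), ← div_eq_mul_inv,
    le_div_iff₀ (by positivity)]
  have hE : Real.exp |t| * Real.exp (-(2 * |t|)) ≤ 1 := by
    rw [← Real.exp_add, Real.exp_le_one_iff]
    linarith [abs_nonneg t]
  calc |t| ^ n * weight t * (1 + t ^ 2)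
      ≤ |t| ^ n * (2 * (|t| * Real.exp (-(2 * |t|)))) * (1 + |t| ^ 2) := by
        rw [sq_abs]
        have := weight_le t
        gcongr
    _ = 2 * (|t| ^ (n + 1) + |t| ^ (n + 3)) * Real.exp (-(2 * |t|)) := by ring
    _ ≤ 2 * ((n + 1).factorial * Real.exp |t| + (n + 3).factorial * Real.exp |t|)
        * Real.exp (-(2 * |t|)) := by
        have h1 := hb (n + 1) t
        have h2 := hb (n + 3) t
        gcongr
    _ = 2 * ((n + 1).factorial + (n + 3).factorial) *
        (Real.exp |t| * Real.exp (-(2 * |t|))) := by ring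
    _ ≤ 2 * ((n + 1).factorial + (n + 3).factorial) := by
        nlinarith [Nat.cast_nonneg (α := ℝ) (n + 1).factorial,
          Nat.cast_nonneg (α := ℝ) (n + 3).factorial]

lemma integrable_eval_mul_weight (p : ℝ[X]) : Integrable fun t : ℝ => p.eval t * weight t := by
  simp_rw [eval_eq_sum_range, Finset.sum_mul, mul_assoc]
  exact integrable_finsetSum _ fun i _ => (integrable_pow_mul_weight i).const_mul _

lemma norm_squareProd_le (k : ℕ) {R : ℝ} (hR : 1 ≤ R) {z : ℂ} (hz : ‖z‖ ≤ 2 * R) :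
    ‖squareProd k z‖ ≤ (∏ j ∈ Finset.range k, (((j : ℝ) + 1) ^ 2 + 4)) * R ^ (2 * k) := by
  rw [squareProd, norm_prod, pow_mul, ← Finset.card_range k, ← Finset.prod_const,
    Finset.card_range, ← Finset.prod_mul_distrib]
  refine Finset.prod_le_prod (fun _ _ => norm_nonneg _) fun j _ => ?_
  have h1 : ‖((j : ℂ) + 1) ^ 2‖ = ((j : ℝ) + 1) ^ 2 := by
    rw [norm_pow, ← Nat.cast_succ, Complex.norm_natCast]; push_cast; rfl
  have h2 : ‖z‖ ^ 2 ≤ (2 * R) ^ 2 := by gcongr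
  calc ‖((j : ℂ) + 1) ^ 2 + z ^ 2‖ ≤ ((j : ℝ) + 1) ^ 2 + ‖z‖ ^ 2 := by
        rw [← h1, ← norm_pow]; exact norm_add_le _ _
    _ ≤ (((j : ℝ) + 1) ^ 2 + 4) * R ^ 2 := by
        have h3 : (1 : ℝ) ≤ R ^ 2 := one_le_pow₀ hR
        nlinarith [mul_nonneg (sq_nonneg ((j : ℝ) + 1)) (sub_nonneg.2 h3)]

/-- On the vertical sides of the rectangle the integrand decays exponentially. -/
lemma norm_contourFun_le (k : ℕ) : ∃ K : ℝ, ∀ R : ℝ, 1 ≤ R → ∀ z : ℂ, |z.re| = R →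
    |z.im| ≤ 1 / 2 → ‖contourFun k z‖ ≤ K * (R ^ (2 * k + 3) * Real.exp (-R)) := by
  refine ⟨128 * ∏ j ∈ Finset.range k, (((j : ℝ) + 1) ^ 2 + 4), fun R hR z hre him => ?_⟩
  have hz0 : z ≠ 0 := by
    rintro rfl
    simp at hre
    linarith
  have hz : ‖z‖ ≤ 2 * R := (Complex.norm_le_abs_re_add_abs_im z).trans (by linarith)
  have hP := norm_squareProd_le k hR hz
  have hE := Real.exp_pos (Real.pi * R)
  have hpiR : 1 ≤ Real.pi * R := by nlinarith [Real.pi_gt_three]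
  have hge : 2 ≤ Real.exp (Real.pi * R) := by linarith [Real.add_one_le_exp (Real.pi * R)]
  have hle : Real.exp (-(Real.pi * R)) ≤ 1 := Real.exp_le_one_iff.2 (by linarith)
  have n1 : ‖Complex.exp (Real.pi * z)‖ = Real.exp (Real.pi * z.re) := by
    rw [Complex.norm_exp]; simp
  have n2 : ‖Complex.exp (-(Real.pi * z))‖ = Real.exp (-(Real.pi * z.re)) := by
    rw [Complex.norm_exp]; simp
  have hcases : (‖Complex.exp (Real.pi * z)‖ = Real.exp (Real.pi * R) ∧
      ‖Complex.exp (-(Real.pi * z))‖ = Real.exp (-(Real.pi * R))) ∨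
      (‖Complex.exp (Real.pi * z)‖ = Real.exp (-(Real.pi * R)) ∧
      ‖Complex.exp (-(Real.pi * z))‖ = Real.exp (Real.pi * R)) := by
    rw [n1, n2]
    rcases abs_choice z.re with h | h
    · rw [hre] at h; left; rw [← h]; exact ⟨rfl, rfl⟩
    · rw [hre] at h
      right
      rw [show z.re = -R by linarith, mul_neg, neg_neg]
      exact ⟨rfl, rfl⟩
  have hch : ‖Complex.cosh (Real.pi * z)‖ ≤ Real.exp (Real.pi * R) := by
    rw [Complex.cosh, norm_div, Complex.norm_ofNat, div_le_iff₀ two_pos]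
    refine (norm_add_le _ _).trans ?_
    rcases hcases with ⟨h, h'⟩ | ⟨h, h'⟩ <;> rw [h, h'] <;> linarith
  have hsh : Real.exp (Real.pi * R) / 4 ≤ ‖Complex.sinh (Real.pi * z)‖ := by
    rw [Complex.sinh, norm_div, Complex.norm_ofNat, le_div_iff₀ two_pos]
    rcases hcases with ⟨h, h'⟩ | ⟨h, h'⟩
    · refine le_trans ?_ (norm_sub_norm_le _ _)
      rw [h, h']; linarith
    · rw [norm_sub_rev]
      refine le_trans ?_ (norm_sub_norm_le _ _)
      rw [h, h']; linarith
  rw [contourFun_eq hz0, norm_div, norm_mul, norm_mul, norm_pow, norm_pow]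
  have hC : 0 ≤ ∏ j ∈ Finset.range k, (((j : ℝ) + 1) ^ 2 + 4) :=
    Finset.prod_nonneg fun _ _ => by positivity
  have hR0 : 0 ≤ R := by linarith
  have hexp : Real.exp (-(Real.pi * R)) ≤ Real.exp (-R) :=
    Real.exp_le_exp.2 (by nlinarith [Real.pi_gt_three])
  calc ‖z‖ ^ 3 * ‖squareProd k z‖ * ‖Complex.cosh (Real.pi * z)‖
        / ‖Complex.sinh (Real.pi * z)‖ ^ 2
      ≤ (2 * R) ^ 3 * ((∏ j ∈ Finset.range k, (((j : ℝ) + 1) ^ 2 + 4)) * R ^ (2 * k))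
        * Real.exp (Real.pi * R) / (Real.exp (Real.pi * R) / 4) ^ 2 := by gcongr
    _ = 128 * (∏ j ∈ Finset.range k, (((j : ℝ) + 1) ^ 2 + 4)) *
        (R ^ (2 * k + 3) * Real.exp (-(Real.pi * R))) := by
        rw [Real.exp_neg]; field_simp; ring
    _ ≤ _ := by gcongr

lemma integrable_halfProd_mul_weight (k : ℕ) (c : ℝ) :
    Integrable fun t : ℝ => (t ^ 2 - c) * halfProd k t * weight t := by
  have e : ∀ t : ℝ, (t ^ 2 - c) * halfProd k t
      = ((X ^ 2 - C c) * ∏ j ∈ Finset.range k, (C (((j : ℝ) + 1 / 2) ^ 2) + X ^ 2)).eval t := by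
    intro t
    rw [eval_mul, eval_prod]
    simp [halfProd]
  simp_rw [e]
  exact integrable_eval_mul_weight _

/-- The integral of `contourFun k` along the boundary of the rectangle with vertices
`± R ± i / 2` vanishes; let `R` tend to infinity. -/
lemma integral_sub_mul_halfProd_mul_weight (k : ℕ) :
    ∫ t : ℝ, (t ^ 2 - (k + 3 / 4)) * halfProd k t * weight t = 0 := by
  set f : ℝ → ℝ := fun t => (t ^ 2 - (k + 3 / 4)) * halfProd k t * weight t with hf
  have hfi : Integrable f := integrable_halfProd_mul_weight k _
  let v : ℝ → ℂ := fun R => ∫ y : ℝ in (-(1 / 2))..(1 / 2), contourFun k (R + y * Complex.I)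
  have hdiff : ∀ z : ℂ, |z.im| ≤ 1 / 2 → DifferentiableAt ℂ (contourFun k) z := by
    intro z hz
    have h1 := sinhQuot_ne_zero hz
    have h2 := differentiable_sinhQuot z
    unfold contourFun squareProd
    refine DifferentiableAt.div (by fun_prop) (h2.pow 2) (pow_ne_zero 2 h1)
  have hrect : ∀ R : ℝ, 2 * ((∫ t in (-R)..R, f t : ℝ) : ℂ) = v (-R) - v R := by
    intro R
    have h := Complex.integral_boundary_rect_eq_zero_of_differentiableOn (contourFun k)
      ⟨-R, -(1 / 2)⟩ ⟨R, 1 / 2⟩ fun z hz => by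
        refine (hdiff z ?_).differentiableWithinAt
        have := hz.2
        rw [Set.mem_preimage, Set.uIcc_of_le (by norm_num)] at this
        exact abs_le.2 ⟨this.1, this.2⟩
    simp only at h
    have hcont : ∀ c : ℝ, |c| ≤ 1 / 2 → IntervalIntegrable
        (fun x : ℝ => contourFun k (x + c * Complex.I)) volume (-R) R := by
      intro c hc
      refine Continuous.intervalIntegrable ?_ _ _
      refine continuous_iff_continuousAt.2 fun x => ?_
      have h1 : ContinuousAt (contourFun k) (x + c * Complex.I) :=
        (hdiff _ (by simpa using hc)).continuousAt
      exact h1.comp (f := fun x : ℝ => (x + c * Complex.I : ℂ)) (by fun_prop)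
    rw [← intervalIntegral.integral_sub (hcont _ (by norm_num [abs_le])) (hcont _ (by norm_num [abs_le]))]
      at h
    have hpt : ∀ x : ℝ, contourFun k (x + ((-(1 / 2) : ℝ) : ℂ) * Complex.I)
        - contourFun k (x + ((1 / 2 : ℝ) : ℂ) * Complex.I) = 2 * Complex.I * (f x : ℝ) := by
      intro x
      rw [hf, ← contourFun_sub_contourFun]
      push_cast
      ring_nf
    simp_rw [hpt] at h
    rw [intervalIntegral.integral_const_mul, intervalIntegral.integral_ofReal] at h
    simp only [smul_eq_mul] at h
    apply mul_left_cancel₀ Complex.I_ne_zero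
    simp only [v]
    linear_combination h
  have hv : Filter.Tendsto v Filter.atTop (nhds 0) ∧
      Filter.Tendsto (fun R => v (-R)) Filter.atTop (nhds 0) := by
    obtain ⟨K, hK⟩ := norm_contourFun_le k
    have hdecay : Filter.Tendsto (fun R : ℝ => K * (R ^ (2 * k + 3) * Real.exp (-R)))
        Filter.atTop (nhds 0) := by
      have := (Real.tendsto_pow_mul_exp_neg_atTop_nhds_zero (2 * k + 3)).const_mul K
      rwa [mul_zero] at this
    have hbound : ∀ R : ℝ, 1 ≤ |R| → ‖v R‖ ≤ K * (|R| ^ (2 * k + 3) * Real.exp (-|R|)) := by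
      intro R hR
      have := intervalIntegral.norm_integral_le_of_norm_le_const (a := -(1 / 2)) (b := 1 / 2)
        (f := fun y : ℝ => contourFun k (R + y * Complex.I))
        (C := K * (|R| ^ (2 * k + 3) * Real.exp (-|R|))) fun y hy => by
          rw [Set.uIoc_of_le (by norm_num)] at hy
          refine hK _ hR _ (by simp) ?_
          simp only [Complex.add_im, Complex.ofReal_im, Complex.mul_im, Complex.ofReal_re,
            Complex.I_im, Complex.I_re]
          rw [abs_le]
          constructor <;> linarith [hy.1, hy.2]
      norm_num at this
      exact this
    constructor
    · refine squeeze_zero_norm' ?_ hdecay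
      filter_upwards [Filter.eventually_ge_atTop 1] with R hR
      have h0 : |R| = R := abs_of_nonneg (by linarith)
      have := hbound R (by rwa [h0])
      rwa [h0] at this
    · refine squeeze_zero_norm' ?_ hdecay
      filter_upwards [Filter.eventually_ge_atTop 1] with R hR
      have h0 : |-R| = R := by rw [abs_neg, abs_of_nonneg (by linarith)]
      have := hbound (-R) (by rwa [h0])
      rwa [h0] at this
  have hlim := intervalIntegral_tendsto_integral hfi Filter.tendsto_neg_atTop_atBot
    Filter.tendsto_id
  have h1 : Filter.Tendsto (fun R : ℝ => 2 * ((∫ t in (-R)..R, f t : ℝ) : ℂ)) Filter.atTop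
      (nhds (2 * ((∫ t, f t : ℝ) : ℂ))) :=
    ((Complex.continuous_ofReal.tendsto _).comp hlim).const_mul 2
  simp_rw [hrect] at h1
  have h2 := tendsto_nhds_unique h1 (hv.2.sub hv.1)
  rw [sub_zero, mul_eq_zero] at h2
  exact_mod_cast h2.resolve_left two_ne_zero

/-! ### The orthogonality measure -/

/-- The measure on the negative half-line for which the polynomials `H n`, `n ≥ 1`, are orthogonal:
the image of `t sinh (π t) / cosh (π t) ^ 2 dt` under `t ↦ -(t ^ 2 + 1 / 4) / 2`. -/
noncomputable def chainMeasure : Measure ℝ :=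
  (volume.withDensity fun t => ENNReal.ofReal (weight t)).map fun t => -(t ^ 2 + 1 / 4) / 2

/-- The polynomial `p (-(t ^ 2 + 1 / 4) / 2)` in `t`. -/
noncomputable def pullback (p : ℝ[X]) : ℝ[X] := p.comp (C (-1 / 2) * (X ^ 2 + C (1 / 4)))

lemma eval_pullback (p : ℝ[X]) (t : ℝ) : (pullback p).eval t = p.eval (-(t ^ 2 + 1 / 4) / 2) := by
  rw [pullback, eval_comp]
  congr 1
  simp
  ring

lemma measurable_ofReal_weight : Measurable fun t => ENNReal.ofReal (weight t) :=
  continuous_weight.measurable.ennreal_ofReal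

lemma integrable_chainMeasure (p : ℝ[X]) : Integrable (fun x => p.eval x) chainMeasure := by
  rw [chainMeasure, integrable_map_measure p.continuous.aestronglyMeasurable (by fun_prop),
    integrable_withDensity_iff measurable_ofReal_weight (by simp)]
  refine (integrable_eval_mul_weight (pullback p)).congr (Filter.Eventually.of_forall fun t => ?_)
  simp only [Function.comp, ENNReal.toReal_ofReal (weight_nonneg t), eval_pullback]

lemma integral_chainMeasure (p : ℝ[X]) :
    ∫ x, p.eval x ∂chainMeasure = ∫ t, (pullback p).eval t * weight t := by
  rw [chainMeasure, integral_map (by fun_prop) p.continuous.aestronglyMeasurable,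
    integral_withDensity_eq_integral_toReal_smul measurable_ofReal_weight (by simp)]
  refine integral_congr_ae (Filter.Eventually.of_forall fun t => ?_)
  simp only [ENNReal.toReal_ofReal (weight_nonneg t), eval_pullback, smul_eq_mul, mul_comm]

/-- Integration of polynomials against `chainMeasure`. -/
noncomputable def chainFunctional : ℝ[X] →ₗ[ℝ] ℝ where
  toFun p := ∫ x, p.eval x ∂chainMeasure
  map_add' p q := by
    simp only [eval_add]
    exact integral_add (integrable_chainMeasure p) (integrable_chainMeasure q)
  map_smul' c p := by
    simp only [eval_smul, smul_eq_mul, RingHom.id_apply]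
    exact integral_const_mul _ _

lemma chainFunctional_apply (p : ℝ[X]) :
    chainFunctional p = ∫ x, p.eval x ∂chainMeasure := rfl

lemma eval_pullback_shiftedProd (k : ℕ) (t : ℝ) :
    (pullback (shiftedProd k)).eval t = halfProd k t := by
  rw [eval_pullback, shiftedProd, eval_prod, halfProd]
  refine Finset.prod_congr rfl fun j _ => ?_
  simp
  ring

lemma chainFunctional_shiftedProd_succ (k : ℕ) :
    chainFunctional (shiftedProd (k + 1)) = (k + 1) ^ 2 * chainFunctional (shiftedProd k) := by
  rw [← sub_eq_zero, ← integral_sub_mul_halfProd_mul_weight k, ← smul_eq_mul, ← map_smul, ← map_sub,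
    chainFunctional_apply, integral_chainMeasure]
  refine integral_congr_ae (Filter.Eventually.of_forall fun t => ?_)
  simp only
  congr 1
  have h1 := eval_pullback_shiftedProd (k + 1) t
  have h0 := eval_pullback_shiftedProd k t
  rw [halfProd_succ] at h1
  rw [eval_pullback] at h0 h1 ⊢
  rw [eval_sub, eval_smul, h0, h1, smul_eq_mul]
  ring

lemma chainFunctional_shiftedProd (k : ℕ) :
    chainFunctional (shiftedProd k) = (k.factorial : ℝ) ^ 2 * chainFunctional 1 := by
  induction k with
  | zero => simp [shiftedProd]
  | succ k ih =>
    rw [chainFunctional_shiftedProd_succ, ih, Nat.factorial_succ]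
    push_cast
    ring

lemma chainFunctional_X_mul_shiftedProd (k : ℕ) :
    chainFunctional (X * shiftedProd (k + 1))
      = -((k + 1).factorial * (k + 2).factorial / 2) * chainFunctional 1 := by
  have e : X * shiftedProd (k + 1) = ((k + 1) * (k + 2) / 2 : ℝ) • shiftedProd (k + 1)
      - (1 / 2 : ℝ) • shiftedProd (k + 2) := by
    refine funext fun z => ?_
    rw [eval_sub, eval_smul, eval_smul, eval_shiftedProd_succ (k + 1), eval_mul, eval_X]
    push_cast
    simp only [smul_eq_mul]
    ring
  rw [e, map_sub, map_smul, map_smul, chainFunctional_shiftedProd, chainFunctional_shiftedProd,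
    Nat.factorial_succ (k + 1)]
  push_cast
  simp only [smul_eq_mul]
  ring

/-- The expansion of `G (n + 2)` in shifted products turns the integral of `z G (n + 2)` into an
alternating sum of binomial coefficients. -/
lemma chainFunctional_X_mul_H (n : ℕ) : chainFunctional (X * H (n + 2)) = 0 := by
  have hG : chainFunctional (X * G (n + 2)) = 0 := by
    rw [G_succ_eq_sum (le_refl (n + 1)), Finset.mul_sum, map_sum]
    have : ∀ k, chainFunctional (X * (C (expansionCoeff (n + 1) k) * shiftedProd (k + 1)))
        = ((-1) ^ k * (n + 1).choose k : ℝ) * (chainFunctional 1 / 2) := by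
      intro k
      rw [mul_left_comm, ← smul_eq_C_mul, map_smul, chainFunctional_X_mul_shiftedProd,
        expansionCoeff, smul_eq_mul]
      have := Nat.factorial_pos (k + 1)
      have := Nat.factorial_pos (k + 2)
      field_simp
      ring
    simp_rw [this]
    rw [← Finset.sum_mul]
    have h := Int.alternating_sum_range_choose_of_ne (n := n + 1) (by omega)
    have h' := congrArg (Int.cast (R := ℝ)) h
    push_cast at h'
    rw [h', zero_mul]
  rw [H, mul_left_comm, ← smul_eq_C_mul, map_smul, hG, smul_zero]

lemma chainFunctional_X_pow_mul_H (j n : ℕ) (h : j < n) :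
    chainFunctional (X ^ (j + 1) * H (n + 1)) = 0 := by
  induction j generalizing n with
  | zero =>
    obtain ⟨n, rfl⟩ : ∃ m, n = m + 1 := ⟨n - 1, by omega⟩
    rw [zero_add, pow_one]
    exact chainFunctional_X_mul_H n
  | succ j ih =>
    obtain ⟨n, rfl⟩ : ∃ m, n = m + 1 := ⟨n - 1, by omega⟩
    have hr := H_recurrence (n + 1)
    have e : X ^ (j + 1 + 1) * H (n + 1 + 1) = X ^ (j + 1) * H (n + 1 + 1 + 1)
        - ((((n + 1 : ℕ) : ℝ) + 2) * ((n + 1 : ℕ) + 1)) • (X ^ (j + 1) * H (n + 1 + 1))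
        + ((((n + 1 : ℕ) : ℝ) + 2) * ((n + 1 : ℕ) + 1) ^ 2 * (n + 1 : ℕ) / 4) •
          (X ^ (j + 1) * H (n + 1)) := by
      rw [show n + 1 + 1 + 1 = n + 1 + 2 by ring, hr, smul_eq_C_mul, smul_eq_C_mul]
      ring
    rw [e, map_add, map_sub, map_smul, map_smul, ih (n + 1) (by omega), ih (n + 1 + 1) (by omega),
      ih n (by omega)]
    simp

lemma chainFunctional_H_mul_H {m n : ℕ} (h : m < n) :
    chainFunctional (H (m + 1) * H (n + 1)) = 0 := by
  rw [(H (m + 1)).as_sum_range_C_mul_X_pow, natDegree_H, Finset.sum_range_succ',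
    coeff_zero_H_succ, map_zero, zero_mul, add_zero, Finset.sum_mul, map_sum]
  refine Finset.sum_eq_zero fun j hj => ?_
  rw [mul_assoc, ← smul_eq_C_mul, map_smul,
    chainFunctional_X_pow_mul_H j n (by have := Finset.mem_range.1 hj; omega), smul_zero]

lemma isOrthogonal_chainMeasure : IsOrthogonal chainMeasure fun n : ℕ => H (n + 1) := by
  refine ⟨fun i j => ?_, fun i j hij => ?_⟩
  · simpa using integrable_chainMeasure (H (i + 1) * H (j + 1))
  · simp_rw [← eval_mul]
    rw [← chainFunctional_apply]
    rcases lt_or_gt_of_ne hij with h | h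
    · exact chainFunctional_H_mul_H h
    · rw [mul_comm]; exact chainFunctional_H_mul_H h

lemma integral_sq_chainMeasure_pos {p : ℝ[X]} (hp : p ≠ 0) :
    0 < ∫ x, p.eval x ^ 2 ∂chainMeasure := by
  simp_rw [← eval_pow]
  rw [integral_chainMeasure]
  have h0 : ∀ t : ℝ, 0 ≤ (pullback (p ^ 2)).eval t * weight t := fun t => by
    rw [eval_pullback, eval_pow]
    exact mul_nonneg (sq_nonneg _) (weight_nonneg t)
  refine lt_of_le_of_ne (integral_nonneg h0) fun h => hp ?_
  have hae := (integral_eq_zero_iff_of_nonneg h0 (integrable_eval_mul_weight _)).1 h.symm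
  have hfun := (Continuous.ae_eq_iff_eq volume
    ((pullback (p ^ 2)).continuous.mul continuous_weight) continuous_const).1 hae
  refine eq_zero_of_infinite_isRoot p
    ((Set.infinite_of_injOn_mapsTo (s := Set.Ioi (0 : ℝ)) (f := fun t => -(t ^ 2 + 1 / 4) / 2)
      ?_ ?_ (Set.Ioi_infinite 0)))
  · intro s hs t ht hst
    have hs' : (0 : ℝ) < s := hs
    have ht' : (0 : ℝ) < t := ht
    have : s ^ 2 = t ^ 2 := by simp only at hst; linarith
    exact (sq_eq_sq₀ hs'.le ht'.le).1 this
  · intro t ht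
    have : (pullback (p ^ 2)).eval t * weight t = 0 := congrFun hfun t
    rw [eval_pullback, eval_pow] at this
    exact pow_eq_zero_iff two_ne_zero |>.1
      ((mul_eq_zero.1 this).resolve_right (weight_pos ht).ne')

/-! ### Orthogonality of the whole sequence -/

lemma isOrthogonal_dirac : IsOrthogonal (Measure.dirac (0 : ℝ)) H := by
  refine ⟨fun i j => ?_, fun i j hij => ?_⟩
  · exact integrable_dirac enorm_lt_top
  · rw [integral_dirac, ← coeff_zero_eq_eval_zero, ← coeff_zero_eq_eval_zero]
    rcases i with _ | i
    · obtain ⟨j, rfl⟩ : ∃ m, j = m + 1 := ⟨j - 1, by omega⟩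
      rw [coeff_zero_H_succ, mul_zero]
    · rw [coeff_zero_H_succ, zero_mul]

/-- Orthogonality of `H 0`, `H 1`, `H 2` makes the first two moments vanish. -/
lemma eq_dirac_of_isOrthogonal {μ : Measure ℝ} [IsProbabilityMeasure μ] (h : IsOrthogonal μ H) :
    μ = Measure.dirac 0 := by
  have h2 : ∀ x : ℝ, (H 2).eval x = x ^ 2 + 2 * x := by
    intro x
    have := eval_H_recurrence 0 x
    rw [zero_add, H_one] at this
    rw [this]
    simp
    ring
  have i1 := h.2 1 0 one_ne_zero
  have i2 := h.2 2 0 two_ne_zero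
  have hint1 := h.1 1 0
  have hint2 := h.1 1 1
  simp only [H_zero, H_one, h2, eval_one, eval_X, mul_one] at i1 i2 hint1 hint2
  simp only [← sq] at hint2
  rw [integral_add hint2 (hint1.const_mul 2), integral_const_mul, i1, mul_zero, add_zero,
    integral_eq_zero_iff_of_nonneg (fun x => sq_nonneg x) hint2] at i2
  have hae : (id : ℝ → ℝ) =ᵐ[μ] fun _ => 0 := i2.mono fun x hx =>
    pow_eq_zero_iff two_ne_zero |>.1 hx
  have : μ.map id = μ.map fun _ => (0 : ℝ) := Measure.map_congr hae
  rwa [Measure.map_id, Measure.map_const, measure_univ, one_smul] at this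

end RandomConvexChain

theorem theorem2p3 :
    -- the normalising constants, and the normalised polynomials are monic of degree `n`
    (∀ n : ℕ, RandomConvexChain.vertexProb n n
      = 2 ^ n / ((n.factorial : ℝ) * ((n + 1).factorial : ℝ))) ∧
    (∀ n : ℕ, (RandomConvexChain.H n).Monic ∧ (RandomConvexChain.H n).natDegree = n) ∧
    -- initial data and the three-term recurrence
    RandomConvexChain.H 0 = 1 ∧
    RandomConvexChain.H 1 = X ∧
    (∀ n : ℕ, 2 ≤ n → ∀ z : ℝ,
      (RandomConvexChain.H n).eval z
        = (z + (n : ℝ) * ((n : ℝ) - 1)) * (RandomConvexChain.H (n - 1)).eval z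
          - (n : ℝ) * ((n : ℝ) - 1) ^ 2 * ((n : ℝ) - 2) / 4
            * (RandomConvexChain.H (n - 2)).eval z) ∧
    -- the whole sequence is orthogonal for exactly one normalised Borel measure
    (∃! μ : Measure ℝ, IsProbabilityMeasure μ ∧
      RandomConvexChain.IsOrthogonal μ RandomConvexChain.H) ∧
    -- the members of positive degree are orthogonal with positive norms
    (∃ μ : Measure ℝ,
      RandomConvexChain.IsOrthogonal μ (fun n : ℕ => RandomConvexChain.H (n + 1)) ∧
      ∀ n : ℕ, 0 < ∫ x, (RandomConvexChain.H (n + 1)).eval x ^ 2 ∂μ) := by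
  open RandomConvexChain in
  refine ⟨vertexProb_self, fun n => ⟨monic_H n, natDegree_H n⟩, H_zero, H_one, fun n hn z => ?_,
    ⟨Measure.dirac 0, ⟨Measure.dirac.isProbabilityMeasure, isOrthogonal_dirac⟩,
      fun μ ⟨_, hμ⟩ => eq_dirac_of_isOrthogonal hμ⟩,
    chainMeasure, isOrthogonal_chainMeasure,
    fun n => integral_sq_chainMeasure_pos (monic_H (n + 1)).ne_zero⟩
  obtain ⟨m, rfl⟩ := Nat.exists_eq_add_of_le' hn
  rw [eval_H_recurrence]
  push_cast
  ring
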